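/- Let $(\mathcal X,g)$ be a closed (nonempty, compact, connected, without boundary) smooth Riemannian manifold of dimension $\dim(\mathcal X)\ge 2$, and let $d$ be the distance induced by $g$ (the infimum of the lengths of paths between two points). For a homeomorphism $F:\mathcal X\to\mathcal X$ put $d_n(x,y)=\max_{0\le k<n}d(F^kx,F^ky)$, let $N_d(n,\epsilon)$ be the maximal cardinality of an $(n,\epsilon)$-separated set, i.e. of a set whose distinct points $x,y$ satisfy $d_n(x,y)>\epsilon$, and define the upper metric mean dimension $$\overline{\mathrm{mdim}}(\mathcal X,d,F)=\limsup_{\epsilon\to0^+}\frac{1}{|\log\epsilon|}\,\limsup_{n\to\infty}\frac1n\log N_d(n,\epsilon).$$ Let $H(\mathcal X)$ be the space of homeomorphisms of $\mathcal X$ with the $C^0$ topology (uniform convergence), and let $\mathrm{Fix}\subseteq H(\mathcal X)$ be the subspace of homeomorphisms that have a fixed point. Then: 1. the set $\{F\in \mathrm{Fix}:\overline{\mathrm{mdim}}(\mathcal X,d,F)=\dim(\mathcal X)\}$ is dense in $\mathrm{Fix}$; 2. the set $\{F\in H(\mathcal X):\overline{\mathrm{mdim}}(\mathcal X,d,F)>0\}$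 is dense in $H(\mathcal X)$. -/

import Mathlib

open scoped Manifold ContDiff Bundle Topology

noncomputable section

namespace MetricMeanDimension

/-- The dynamical metric `d_n(x, y) = max_{0 ≤ k < n} d(T^k x, T^k y)`. -/
def dynDist {X : Type*} [MetricSpace X] (T : X → X) (n : ℕ) (x y : X) : ℝ :=
  ⨆ k : Fin n, dist (T^[k] x) (T^[k] y)

/-- A set is `(n, ε)`-separated if distinct points of it are at `d_n`-distance greater than `ε`. -/
def IsDynSeparated {X : Type*} [MetricSpace X] (T : X → X) (n : ℕ) (ε : ℝ) (s : Set X) : Prop :=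
  s.Pairwise fun x y => ε < dynDist T n x y

/-- `N_d(n, ε)`: the maximal cardinality of an `(n, ε)`-separated set (a supremum in `ℕ∞`). -/
def sepCard {X : Type*} [MetricSpace X] (T : X → X) (n : ℕ) (ε : ℝ) : ℕ∞ :=
  ⨆ (s : Set X) (_ : IsDynSeparated T n ε s), s.encard

/-- `S(X, d, ε) = limsup_{n → ∞} (1/n) log N_d(n, ε)`. -/
def sepEntropy {X : Type*} [MetricSpace X] (T : X → X) (ε : ℝ) : EReal :=
  Filter.limsup (fun n : ℕ => ENNReal.log (sepCard T n ε : ENNReal) / (n : EReal)) Filter.atTop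

/-- The upper metric mean dimension `limsup_{ε → 0⁺} S(X, d, ε) / |log ε|`. -/
def upperMDim {X : Type*} [MetricSpace X] (T : X → X) : EReal :=
  Filter.limsup (fun ε : ℝ => sepEntropy T ε / ((|Real.log ε| : ℝ) : EReal)) (𝓝[>] (0 : ℝ))

/-- The `C⁰` topology on the space `H(X)` of homeomorphisms of `X`: the topology induced from the
compact-open topology on `C(X, X)`. For a compact metric space `X` it is the topology of uniform
convergence, see `mem_closure_homeo_iff`. -/
instance homeoTopology {X : Type*} [TopologicalSpace X] : TopologicalSpace (X ≃ₜ X) :=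
  TopologicalSpace.induced (fun F : X ≃ₜ X => (⟨F, F.continuous⟩ : C(X, X))) inferInstance

/-- On a compact metric space, closeness in `homeoTopology` is uniform closeness. -/
theorem mem_closure_homeo_iff {X : Type*} [MetricSpace X] [CompactSpace X]
    (A : Set (X ≃ₜ X)) (F : X ≃ₜ X) :
    F ∈ closure A ↔ ∀ ε : ℝ, 0 < ε → ∃ G ∈ A, ∀ x, dist (F x) (G x) < ε := by
  rw [closure_induced, Metric.mem_closure_iff]
  constructor
  · intro h ε hε
    obtain ⟨_, ⟨G, hG, rfl⟩, hd⟩ := h ε hε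
    exact ⟨G, hG, (ContinuousMap.dist_lt_iff hε).1 hd⟩
  · intro h ε hε
    obtain ⟨G, hG, hd⟩ := h ε hε
    exact ⟨_, ⟨G, hG, rfl⟩, (ContinuousMap.dist_lt_iff hε).2 hd⟩

end MetricMeanDimension

end

/-! Upper bound. Geodesic distance and chart distance are locally comparable, so `X` splits into
`O(M ^ n)` pieces of diameter `O(1 / M)`. A separated orbit segment is determined by its itinerary
through pieces of diameter at most `ε`, so the entropy at scale `ε` is at most `n * |log ε| + O(1)`,
and every self-map has upper metric mean dimension at most `n` (`upperMDim_le`).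

Lower bound. If `f` and a connected open set `U` satisfy `f x ∈ U` for some `x ∈ U`, then `U ∩ f⁻¹
U` contains a grid of `M ^ n` points with mesh of order `1 / M`. A perturbation supported in `U`
creates a full shift whose symbols are these grid points (`exists_shift_of_separated`), which gives
entropy `n * log M` at a scale of order `1 / M`. Around a fixed point `p` there are infinitely many
disjoint annuli of this kind shrinking to `p` (`exists_disjoint_annuli`). Performing the
construction in each of them, at finer and finer scales, and gluing gives dimension at least `n`.
Applied to the `q`-th iterate near a point of period `q`, the same argument gives at least `n / q`
(`exists_perturbation`).

The full shift needs no hyperbolicity. In dimension at least two, finitely many points can be moved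
freely inside disjoint connected open sets. Hence one can realise successively every transition
between words of length `L`, then `L + 2`, and so on, by sets that shrink together with their
preimages (`IsDeBruijnFamily.exists_refinement`). The corrections are summable, also for the
inverses, so the limit is a homeomorphism, and nested sets of words yield one orbit for each symbol
sequence.

Density. With a fixed point, the perturbation takes place in a small ball around it. In general,
pigeonhole gives a small open set to which some point returns, and closing up a return of minimal
time produces a periodic point, hence dimension at least `n / q > 0`. -/

noncomputable section

namespace MetricMeanDimension

/-! ### Riemannian distance versus chart distance -/

section

open Set Metric MeasureTheory Bundle
open scoped NNReal ENNReal

section Chart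

variable {E : Type*} [NormedAddCommGroup E] [NormedSpace ℝ E]
  {H : Type*} [TopologicalSpace H] (I : ModelWithCorners ℝ E H)
  {M : Type*} [PseudoEMetricSpace M] [ChartedSpace H M]
  [RiemannianBundle (fun (x : M) ↦ TangentSpace I x)]
  [IsManifold I 1 M] [IsContinuousRiemannianBundle E (fun (x : M) ↦ TangentSpace I x)]

/-- The derivative of an extended chart is locally bounded. -/
theorem eventually_enorm_mfderiv_extChartAt_apply_le (x : M) :
    ∃ C > (0 : ℝ≥0), ∀ᶠ y in 𝓝 x, ∀ v : TangentSpace I y,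
      enorm (E := E) (mfderiv% (extChartAt I x) y v) ≤ C * ‖v‖ₑ := by
  obtain ⟨C, C_pos, hC⟩ := eventually_enorm_mfderiv_extChartAt_lt I x
  refine ⟨C, C_pos, ?_⟩
  filter_upwards [hC] with y hy v
  have := fun a b => @ContinuousLinearMap.le_opENorm ℝ ℝ (TangentSpace I y) E _ _ _ _ _ _ (RingHom.id ℝ) _ a b
  refine le_trans (this (mfderiv I 𝓘(ℝ, E) (extChartAt I x) y) v) ?_
  exact mul_le_mul_left hy.le _

/-- The derivative of the inverse of an extended chart is locally bounded. -/
theorem eventually_enorm_mfderivWithin_extChartAt_symm_apply_le (x : M) :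
    ∃ C > (0 : ℝ≥0), ∀ᶠ y in 𝓝[range I] (extChartAt I x x), ∀ v : E,
      ‖mfderiv[range I] (extChartAt I x).symm y v‖ₑ ≤ C * ‖v‖ₑ := by
  obtain ⟨C, C_pos, hC⟩ := eventually_enorm_mfderivWithin_symm_extChartAt_lt I x
  refine ⟨C, C_pos, ?_⟩
  filter_upwards [hC] with y hy v
  have := fun a b => @ContinuousLinearMap.le_opENorm ℝ ℝ E (TangentSpace I ((extChartAt I x).symm y)) _ _ _ _ _ _ (RingHom.id ℝ) _ a b
  refine le_trans (this (mfderivWithin 𝓘(ℝ, E) I (extChartAt I x).symm (range I) y) v) ?_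
  exact mul_le_mul_left hy.le _

variable [IsRiemannianManifold I M]

/-- The inverse of an extended chart is locally Lipschitz. -/
theorem eventually_edist_le_edist_extChartAt (x : M) :
    ∃ C > (0 : ℝ≥0), ∃ U ∈ 𝓝 x, ∀ y ∈ U, ∀ z ∈ U,
      edist y z ≤ C * edist (extChartAt I x y) (extChartAt I x z) := by
  rcases eventually_enorm_mfderivWithin_extChartAt_symm_apply_le I x with ⟨C, C_pos, hC⟩
  obtain ⟨r, r_pos, hr⟩ : ∃ r > 0,
      ball (extChartAt I x x) r ∩ range I ⊆ (extChartAt I x).target ∩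
        {y | ∀ v : E, ‖mfderiv[range I] (extChartAt I x).symm y v‖ₑ ≤ C * ‖v‖ₑ} :=
    mem_nhdsWithin_iff.1 (Filter.inter_mem (extChartAt_target_mem_nhdsWithin x) hC)
  have A : (extChartAt I x) ⁻¹' (ball (extChartAt I x x) r ∩ range I) ∈ 𝓝 x := by
    apply extChartAt_preimage_mem_nhds_of_mem_nhdsWithin (by simp)
    rw [inter_comm]
    exact inter_mem_nhdsWithin _ (ball_mem_nhds _ r_pos)
  refine ⟨C, C_pos, _, Filter.inter_mem A (chart_source_mem_nhds H x), ?_⟩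
  rintro y ⟨hy, h'y⟩ z ⟨hz, h'z⟩
  -- The competitor path is the chart segment pulled back to `M`; it stays in the region where the
  -- derivative bound holds because a ball intersected with `range I` is convex.
  let η := ContinuousAffineMap.lineMap (R := ℝ) (extChartAt I x y) (extChartAt I x z)
  set γ := (extChartAt I x).symm ∘ η
  have hη : Icc 0 1 ⊆ ⇑η ⁻¹' ((extChartAt I x).target ∩
        {y | ∀ v : E, ‖mfderiv[range I] (extChartAt I x).symm y v‖ₑ ≤ C * ‖v‖ₑ}) := by
    simp only [← image_subset_iff, ContinuousAffineMap.coe_lineMap_eq,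
     ← segment_eq_image_lineMap, η]
    apply Subset.trans _ hr
    exact ((convex_ball _ _).inter I.convex_range).segment_subset hy hz
  simp only [preimage_inter, subset_inter_iff] at hη
  have η_smooth : CMDiff[Icc 0 1] 1 η := by
    apply ContMDiff.contMDiffOn
    rw [contMDiff_iff_contDiff]
    exact ContinuousAffineMap.contDiff _
  rw [IsRiemannianManifold.out (I := I) y z]
  have : Manifold.riemannianEDist I y z ≤ Manifold.pathELength I γ 0 1 := by
    apply Manifold.riemannianEDist_le_pathELength _ _ _ zero_le_one
    · exact (contMDiffOn_extChartAt_symm x).comp η_smooth hη.1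
    · simp [γ, η, ContinuousAffineMap.coe_lineMap_eq, h'y]
    · simp [γ, η, ContinuousAffineMap.coe_lineMap_eq, h'z]
  apply this.trans
  rw [← lintegral_fderiv_lineMap_eq_edist, Manifold.pathELength_eq_lintegral_mfderivWithin_Icc,
    ← lintegral_const_mul' _ _ ENNReal.coe_ne_top]
  apply setLIntegral_mono' measurableSet_Icc (fun t ht ↦ ?_)
  have : mfderiv[Icc 0 1] γ t =
      (mfderiv[range I] (extChartAt I x).symm (η t)) ∘L (mfderiv[Icc 0 1] η t) := by
    apply mfderivWithin_comp
    · exact mdifferentiableWithinAt_extChartAt_symm (hη.1 ht)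
    · exact η_smooth.mdifferentiableOn one_ne_zero t ht
    · exact hη.1.trans (preimage_mono (extChartAt_target_subset_range x))
    · rw [uniqueMDiffWithinAt_iff_uniqueDiffWithinAt]
      exact uniqueDiffOn_Icc zero_lt_one t ht
  have : mfderiv[Icc 0 1] γ t 1 =
      (mfderiv[range I] (extChartAt I x).symm (η t)) (mfderiv[Icc 0 1] η t 1) := congr($this 1)
  rw [this]
  refine (hη.2 ht _).trans ?_
  simp only [mfderivWithin_eq_fderivWithin]
  exact le_of_eq rfl

/-- An extended chart is locally Lipschitz. -/
theorem eventually_edist_extChartAt_le_edist (x : M) :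
    ∃ C > (0 : ℝ≥0), ∃ U ∈ 𝓝 x, ∀ y ∈ U, ∀ z ∈ U,
      edist (extChartAt I x y) (extChartAt I x z) ≤ C * edist y z := by
  rcases eventually_enorm_mfderiv_extChartAt_apply_le I x with ⟨C, C_pos, hC⟩
  -- Radius `3r`: a path of length less than `2r` starting in the ball of radius `r` cannot leave
  -- it.
  obtain ⟨r, r_pos, hr⟩ : ∃ r > (0 : ℝ≥0), eball x (r + (r + r)) ⊆
      {y | ∀ v : TangentSpace I y, enorm (E := E) (mfderiv% (extChartAt I x) y v) ≤ C * ‖v‖ₑ} ∩ (extChartAt I x).source := by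
    obtain ⟨ε, ε_pos, hε⟩ := EMetric.mem_nhds_iff.1
      (Filter.inter_mem hC (extChartAt_source_mem_nhds (I := I) x))
    obtain ⟨r, r_pos, hr⟩ := ENNReal.lt_iff_exists_nnreal_btwn.1 ε_pos
    refine ⟨r / 3, div_pos (mod_cast r_pos) (by norm_num), (eball_subset_eball (le_trans (le_of_eq ?_) hr.le)).trans hε⟩
    norm_cast
    ring
  refine ⟨C, C_pos, eball x r, eball_mem_nhds x (mod_cast r_pos), fun y hy z hz ↦ ?_⟩
  refine ENNReal.le_of_forall_pos_le_add fun δ δ_pos _ ↦ ?_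
  have hyz : edist y z < (r : ℝ≥0∞) + (r : ℝ≥0∞) := by
    refine (edist_triangle_right y z x).trans_lt (ENNReal.add_lt_add hy hz)
  -- `L` is a length budget: above the distance, so that some path meets it, within `δ / C` of it,
  -- and at most `2r`.
  obtain ⟨L, hL, hLC, hLr⟩ : ∃ L, edist y z < L ∧ C * L ≤ C * edist y z + δ ∧ L ≤ (r : ℝ≥0∞) + (r : ℝ≥0∞) := by
    have hδ : (0 : ℝ≥0∞) < δ / C := ENNReal.div_pos (mod_cast δ_pos.ne') ENNReal.coe_ne_top
    refine ⟨min (edist y z + δ / C) (r + r),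
      lt_min (ENNReal.lt_add_right hyz.ne_top hδ.ne') hyz, ?_, min_le_right _ _⟩
    calc (C : ℝ≥0∞) * min (edist y z + δ / C) (r + r) ≤ C * (edist y z + δ / C) := by
          gcongr; exact min_le_left _ _
      _ = C * edist y z + δ := by
          rw [mul_add, ENNReal.mul_div_cancel (by simpa using C_pos.ne') ENNReal.coe_ne_top]
  rw [IsRiemannianManifold.out (I := I) y z] at hL
  rcases Manifold.exists_lt_locally_constant_of_riemannianEDist_lt hL zero_lt_one
    with ⟨γ, hγy, hγz, γ_smooth, hγ, -⟩
  have hmem : ∀ t ∈ Icc (0 : ℝ) 1, (∀ v : TangentSpace I (γ t),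
      enorm (E := E) (mfderiv% (extChartAt I x) (γ t) v) ≤ C * ‖v‖ₑ) ∧
      γ t ∈ (extChartAt I x).source := by
    intro t ht
    apply hr
    have : edist y (γ t) < (r : ℝ≥0∞) + (r : ℝ≥0∞) := by
      rw [IsRiemannianManifold.out (I := I)]
      calc _ ≤ Manifold.pathELength I γ 0 t :=
            Manifold.riemannianEDist_le_pathELength γ_smooth.contMDiffOn hγy rfl ht.1
        _ ≤ Manifold.pathELength I γ 0 1 := Manifold.pathELength_mono le_rfl ht.2
        _ < _ := hγ.trans_le hLr
    rw [mem_eball']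
    refine (edist_triangle x y _).trans_lt (ENNReal.add_lt_add ?_ this)
    rwa [mem_eball'] at hy
  let γ' := extChartAt I x ∘ γ
  have hC : CMDiff[Icc 0 1] 1 γ' :=
    contMDiffOn_extChartAt.comp (I' := I) (t := (chartAt H x).source)
      γ_smooth.contMDiffOn (fun t' ht' ↦ by simpa using (hmem t' ht').2)
  calc
      edist (extChartAt I x y) (extChartAt I x z) = ‖γ' 1 - γ' 0‖ₑ := by
        rw [edist_comm, edist_eq_enorm_sub]; simp [γ', hγy, hγz]
    _ ≤ ∫⁻ t' in Icc 0 1, ‖derivWithin γ' (Icc 0 1) t'‖ₑ := by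
      apply enorm_sub_le_lintegral_derivWithin_Icc_of_contDiffOn_Icc _ zero_le_one
      rwa [← contMDiffOn_iff_contDiffOn]
    _ = ∫⁻ t' in Icc (0 : ℝ) 1, enorm (E := E) (mfderiv[Icc 0 1] γ' t' 1) := by
      simp_rw [← fderivWithin_derivWithin, mfderivWithin_eq_fderivWithin]
      rfl
    _ ≤ ∫⁻ t' in Icc 0 1, C * ‖mfderiv[Icc 0 1] γ t' 1‖ₑ := by
      apply setLIntegral_mono' measurableSet_Icc (fun t' ht' ↦ ?_)
      have : mfderiv[Icc 0 1] γ' t' =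
          (mfderiv% (extChartAt I x) (γ t')) ∘L (mfderiv[Icc 0 1] γ t') := by
        apply mfderiv_comp_mfderivWithin
        · exact mdifferentiableAt_extChartAt (by simpa using (hmem t' ht').2)
        · exact (γ_smooth.mdifferentiable one_ne_zero).mdifferentiableOn _ ht'
        · rw [uniqueMDiffWithinAt_iff_uniqueDiffWithinAt]
          exact uniqueDiffOn_Icc zero_lt_one _ ht'
      have : mfderiv[Icc 0 1] γ' t' 1 =
          (mfderiv% (extChartAt I x) (γ t')) (mfderiv[Icc 0 1] γ t' 1) :=
        congr($this 1)
      rw [this]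
      exact (hmem t' ht').1 _
    _ = C * Manifold.pathELength I γ 0 1 := by
      rw [lintegral_const_mul' _ _ ENNReal.coe_ne_top,
          Manifold.pathELength_eq_lintegral_mfderivWithin_Icc]
    _ ≤ C * L := by gcongr
    _ ≤ _ := hLC

end Chart

end

/-! ### Bi-Lipschitz charts, grids and partitions -/

section

open Set Metric

/-- Near each point of `X`, the preferred chart is bi-Lipschitz. -/
def LocallyBilipschitzCharts (n : ℕ) (X : Type*) [MetricSpace X]
    [ChartedSpace (EuclideanSpace ℝ (Fin n)) X] : Prop :=
  ∀ x : X, ∃ C > (0 : ℝ), ∃ U ∈ 𝓝 x, ∀ y ∈ U, ∀ z ∈ U,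
    dist y z ≤ C * dist (chartAt (EuclideanSpace ℝ (Fin n)) x y) (chartAt _ x z) ∧
    dist (chartAt (EuclideanSpace ℝ (Fin n)) x y) (chartAt _ x z) ≤ C * dist y z

theorem locallyBilipschitzCharts_of_isRiemannianManifold (n : ℕ) (X : Type*) [MetricSpace X]
    [ChartedSpace (EuclideanSpace ℝ (Fin n)) X] [IsManifold (𝓡 n) ∞ X]
    [Bundle.RiemannianBundle (fun x : X => TangentSpace (𝓡 n) x)]
    [IsContMDiffRiemannianBundle (𝓡 n) ∞ (EuclideanSpace ℝ (Fin n))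
      (fun x : X => TangentSpace (𝓡 n) x)]
    [IsRiemannianManifold (𝓡 n) X] : LocallyBilipschitzCharts n X := by
  have : IsManifold (𝓡 n) 1 X := IsManifold.of_le (n := ∞) (by norm_num)
  have : IsContinuousRiemannianBundle (EuclideanSpace ℝ (Fin n))
      (fun x : X => TangentSpace (𝓡 n) x) := by
    obtain ⟨g, hg, h⟩ := IsContMDiffRiemannianBundle.exists_contMDiff (IB := 𝓡 n) (n := ∞)
      (F := EuclideanSpace ℝ (Fin n)) (E := fun x : X => TangentSpace (𝓡 n) x)
    exact ⟨g, hg.continuous, h⟩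
  intro x
  obtain ⟨C₁, hC₁, U₁, hU₁, h₁⟩ := eventually_edist_le_edist_extChartAt (𝓡 n) x
  obtain ⟨C₂, hC₂, U₂, hU₂, h₂⟩ := eventually_edist_extChartAt_le_edist (𝓡 n) x
  refine ⟨max C₁ C₂, lt_max_of_lt_left hC₁, U₁ ∩ U₂, Filter.inter_mem hU₁ hU₂,
    fun y hy z hz ↦ ⟨?_, ?_⟩⟩
  · have h := h₁ y hy.1 z hz.1
    rw [edist_nndist, edist_nndist] at h
    have h' : nndist y z ≤ C₁ * nndist (extChartAt (𝓡 n) x y) (extChartAt (𝓡 n) x z) := by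
      exact_mod_cast h
    have h'' : dist y z ≤ C₁ * dist (chartAt (EuclideanSpace ℝ (Fin n)) x y) (chartAt _ x z) := by
      simpa using NNReal.coe_le_coe.2 h'
    exact h''.trans (by gcongr; exact le_max_left _ _)
  · have h := h₂ y hy.2 z hz.2
    rw [edist_nndist, edist_nndist] at h
    have h' : nndist (extChartAt (𝓡 n) x y) (extChartAt (𝓡 n) x z) ≤ C₂ * nndist y z := by
      exact_mod_cast h
    have h'' : dist (chartAt (EuclideanSpace ℝ (Fin n)) x y) (chartAt _ x z) ≤ C₂ * dist y z := by
      simpa using NNReal.coe_le_coe.2 h'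
    exact h''.trans (by gcongr; exact le_max_right _ _)

variable {n : ℕ} {X : Type*} [MetricSpace X] [ChartedSpace (EuclideanSpace ℝ (Fin n)) X]

/-- A nonempty open set contains a copy of a grid with `M ^ n` points and mesh of order `1 / M`. -/
theorem LocallyBilipschitzCharts.exists_grid (hX : LocallyBilipschitzCharts n X) {V : Set X}
    (hV : IsOpen V) (hne : V.Nonempty) :
    ∃ c > (0 : ℝ), ∀ M : ℕ, 0 < M → ∃ f : (Fin n → Fin M) → X, (∀ a, f a ∈ V) ∧
      ∀ a b, a ≠ b → c / M ≤ dist (f a) (f b) := by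
  obtain ⟨x, hx⟩ := hne
  obtain ⟨C, hC, U, hU, h⟩ := hX x
  set φ := chartAt (EuclideanSpace ℝ (Fin n)) x with hφ
  have hxs : x ∈ φ.source := mem_chart_source _ x
  have hN : φ.symm ⁻¹' (U ∩ V) ∩ φ.target ∈ 𝓝 (φ x) := by
    refine Filter.inter_mem ?_ (φ.open_target.mem_nhds (φ.map_source hxs))
    apply (φ.continuousAt_symm (φ.map_source hxs)).preimage_mem_nhds
    rw [φ.left_inv hxs]
    exact Filter.inter_mem hU (hV.mem_nhds hx)
  obtain ⟨r, hr, hrN⟩ := Metric.mem_nhds_iff.1 hN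
  let e := (EuclideanSpace.equiv (Fin n) ℝ).symm
  let K : ℝ := ‖(e : (Fin n → ℝ) →L[ℝ] EuclideanSpace ℝ (Fin n))‖
  have hK : 0 ≤ K := norm_nonneg _
  -- `K` compares the sup norm with the Euclidean norm; a cube of side `s` then fits in the ball of
  -- radius `r`.
  let s : ℝ := r / (K + 1)
  have hs : 0 < s := by positivity
  refine ⟨s / C, by positivity, fun M hM ↦ ?_⟩
  have hM' : (0 : ℝ) < M := by exact_mod_cast hM
  let g : (Fin n → Fin M) → EuclideanSpace ℝ (Fin n) :=
    fun a ↦ φ x + e (fun i ↦ s / M * (a i : ℝ))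
  have hg : ∀ a, g a ∈ φ.symm ⁻¹' (U ∩ V) ∩ φ.target := by
    intro a
    apply hrN
    rw [mem_ball, dist_eq_norm, add_sub_cancel_left]
    have h1 : ‖(fun i ↦ s / M * (a i : ℝ) : Fin n → ℝ)‖ ≤ s := by
      rw [pi_norm_le_iff_of_nonneg hs.le]
      intro i
      rw [Real.norm_of_nonneg (by positivity)]
      have : ((a i : ℕ) : ℝ) ≤ M := by exact_mod_cast (a i).2.le
      calc s / M * (a i : ℝ) ≤ s / M * M := by gcongr
        _ = s := by field_simp
    calc ‖e (fun i ↦ s / M * (a i : ℝ))‖ ≤ K * ‖(fun i ↦ s / M * (a i : ℝ) : Fin n → ℝ)‖ :=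
          (e : (Fin n → ℝ) →L[ℝ] EuclideanSpace ℝ (Fin n)).le_opNorm _
      _ ≤ K * s := by gcongr
      _ < (K + 1) * s := by nlinarith
      _ = r := by simp only [s]; field_simp
  refine ⟨fun a ↦ φ.symm (g a), fun a ↦ (hg a).1.2, fun a b hab ↦ ?_⟩
  have h2 := (h _ (hg a).1.1 _ (hg b).1.1).2
  rw [φ.right_inv (hg a).2, φ.right_inv (hg b).2] at h2
  obtain ⟨i, hi⟩ := Function.ne_iff.1 hab
  have h3 : s / M ≤ dist (g a) (g b) := by
    have h4 : ‖(g a - g b) i‖ ≤ ‖g a - g b‖ := PiLp.norm_apply_le _ i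
    rw [dist_eq_norm]
    refine le_trans ?_ h4
    have h5 : (g a - g b) i = s / M * ((a i : ℝ) - (b i : ℝ)) := by
      simp [g, e, mul_sub]
    rw [h5, norm_mul, Real.norm_of_nonneg (by positivity)]
    have h6 : (1 : ℝ) ≤ ‖(a i : ℝ) - (b i : ℝ)‖ := by
      have h7 : ((a i : ℕ) : ℤ) - (b i : ℕ) ≠ 0 := by
        intro h8
        exact hi (Fin.ext (by omega))
      have := Int.one_le_abs h7
      rw [Real.norm_eq_abs]
      exact_mod_cast this
    nlinarith [div_pos hs hM']
  rw [div_right_comm, div_le_iff₀ hC]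
  linarith

/-- A compact space with bi-Lipschitz charts can be split into `O(M ^ n)` pieces of diameter
`O(1 / M)`. -/
theorem LocallyBilipschitzCharts.exists_partition [CompactSpace X]
    (hX : LocallyBilipschitzCharts n X) :
    ∃ (t : Finset X) (C : ℝ), 0 < C ∧ ∀ M : ℕ, 0 < M → ∃ f : X → t × (Fin n → Fin M),
      ∀ y z, f y = f z → dist y z ≤ C / M := by
  choose C hC U hU h using hX
  let φ := fun x : X ↦ chartAt (EuclideanSpace ℝ (Fin n)) x
  have hW : ∀ x, U x ∩ φ x ⁻¹' ball (φ x x) 1 ∈ 𝓝 x := fun x ↦ Filter.inter_mem (hU x) <|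
    ((φ x).continuousAt (mem_chart_source _ x)).preimage_mem_nhds (ball_mem_nhds _ one_pos)
  obtain ⟨t, ht⟩ := CompactSpace.elim_nhds_subcover _ hW
  have hcov : ∀ y : X, ∃ x : t, y ∈ U x ∩ φ x ⁻¹' ball (φ x x) 1 := by
    intro y
    have : y ∈ ⋃ x ∈ t, U x ∩ φ x ⁻¹' ball (φ x x) 1 := by rw [ht]; trivial
    simp only [mem_iUnion] at this
    obtain ⟨x, hx, hy⟩ := this
    exact ⟨⟨x, hx⟩, hy⟩
  choose p hp using hcov
  let e := (EuclideanSpace.equiv (Fin n) ℝ).symm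
  let K : ℝ := ‖(e : (Fin n → ℝ) →L[ℝ] EuclideanSpace ℝ (Fin n))‖
  have hK : 0 ≤ K := norm_nonneg _
  let S : ℝ := ∑ x ∈ t, C x
  have hS : 0 ≤ S := Finset.sum_nonneg fun x _ ↦ (hC x).le
  have hCS : ∀ x ∈ t, C x ≤ S := fun x hx ↦
    Finset.single_le_sum (f := C) (fun x _ ↦ (hC x).le) hx
  refine ⟨t, 2 * S * K + 1, by positivity, fun M hM ↦ ?_⟩
  have hM' : (0 : ℝ) < M := by exact_mod_cast hM
  -- Chart coordinates rescaled from `(-1, 1)` to `(0, M)`; their integer parts name the cell.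
  let u : X → Fin n → ℝ := fun y i ↦ ((φ (p y) y - φ (p y) (p y)) i + 1) / 2 * M
  have hu : ∀ y i, 0 ≤ u y i ∧ u y i < M := by
    intro y i
    have h1 : ‖(φ (p y) y - φ (p y) (p y)) i‖ < 1 := by
      refine (PiLp.norm_apply_le _ i).trans_lt ?_
      rw [← dist_eq_norm]
      exact (hp y).2
    rw [Real.norm_eq_abs, abs_lt] at h1
    constructor
    · exact mul_nonneg (by linarith) hM'.le
    · simp only [u]
      nlinarith
  refine ⟨fun y ↦ (p y, fun i ↦ ⟨⌊u y i⌋₊, (Nat.floor_lt (hu y i).1).2 (hu y i).2⟩),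
    fun y z hyz ↦ ?_⟩
  simp only [Prod.mk.injEq] at hyz
  obtain ⟨hpe, hfl⟩ := hyz
  have hz : z ∈ U (p y) := by rw [hpe]; exact (hp z).1
  have h1 := (h (p y) y (hp y).1 z hz).1
  have h2 : dist (φ (p y) y) (φ (p y) z) ≤ K * (2 / M) := by
    rw [dist_eq_norm]
    let v : Fin n → ℝ := e.symm (φ (p y) y - φ (p y) z)
    have hv : φ (p y) y - φ (p y) z = e v := by simp [v]
    rw [hv]
    refine ((e : (Fin n → ℝ) →L[ℝ] EuclideanSpace ℝ (Fin n)).le_opNorm v).trans ?_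
    gcongr
    rw [pi_norm_le_iff_of_nonneg (by positivity)]
    intro i
    have h3 : |u y i - u z i| < 1 := by
      have h4 : ⌊u y i⌋₊ = ⌊u z i⌋₊ := by simpa using congrFun hfl i
      have a1 := Nat.floor_le (hu y i).1
      have a2 := Nat.floor_le (hu z i).1
      have a3 := Nat.lt_floor_add_one (u y i)
      have a4 := Nat.lt_floor_add_one (u z i)
      rw [← h4] at a2 a4
      rw [abs_lt]
      constructor <;> linarith
    have h5 : u y i - u z i = v i * (M / 2) := by
      have : v i = φ (p y) y i - φ (p y) z i := by simp [v, e]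
      rw [this]
      simp only [u, ← hpe, PiLp.sub_apply]
      ring
    rw [h5, abs_mul, abs_of_pos (by positivity : (0 : ℝ) < M / 2)] at h3
    rw [Real.norm_eq_abs, le_div_iff₀ hM']
    linarith
  calc dist y z ≤ C (p y) * (K * (2 / M)) := h1.trans (by gcongr; exact (hC _).le)
    _ ≤ S * (K * (2 / M)) := by gcongr; exact hCS _ (p y).2
    _ = (2 * S * K) / M := by ring
    _ ≤ _ := by gcongr; linarith

end

/-! ### Entropy at a fixed scale and metric mean dimension -/

section

open Set Metric Filter

section Entropy

variable {X : Type*} [MetricSpace X]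

/-- Two points with the same itinerary of length `m` stay `ε`-close up to time `m`, so itineraries
are injective on a separated set. -/
theorem sepCard_le_of_partition {ι : Type*} [Fintype ι] (T : X → X) {ε : ℝ} (hε : 0 ≤ ε)
    (f : X → ι) (hf : ∀ y z, f y = f z → dist y z ≤ ε) (m : ℕ) :
    sepCard T m ε ≤ ((Fintype.card ι ^ m : ℕ) : ℕ∞) := by
  refine iSup₂_le fun s hs ↦ ?_
  have hinj : InjOn (fun y (k : Fin m) ↦ f (T^[k] y)) s := by
    intro y hy z hz hyz
    by_contra hne
    refine (hs hy hz hne).not_ge (Real.iSup_le (fun k ↦ hf _ _ (congrFun hyz k)) hε)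
  calc s.encard ≤ (univ : Set (Fin m → ι)).encard :=
        encard_le_encard_of_injOn (fun _ _ ↦ mem_univ _) hinj
    _ = _ := by simp [encard_univ]

theorem sepEntropy_le_of_partition [Nonempty X] {ι : Type*} [Fintype ι] (T : X → X) {ε : ℝ}
    (hε : 0 ≤ ε) (f : X → ι) (hf : ∀ y z, f y = f z → dist y z ≤ ε) :
    sepEntropy T ε ≤ ((Real.log (Fintype.card ι) : ℝ) : EReal) := by
  refine limsup_le_of_le (by isBoundedDefault) ?_
  filter_upwards [eventually_gt_atTop 0] with m hm
  have hι : 0 < Fintype.card ι := Fintype.card_pos_iff.2 ⟨f (Classical.arbitrary X)⟩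
  have h1 : ENNReal.log (sepCard T m ε : ENNReal) ≤
      ((m * Real.log (Fintype.card ι) : ℝ) : EReal) := by
    have h2 : ((sepCard T m ε : ℕ∞) : ENNReal) ≤ (Fintype.card ι : ENNReal) ^ m := by
      have := sepCard_le_of_partition T hε f hf m
      have h3 : ((sepCard T m ε : ℕ∞) : ENNReal) ≤ ((Fintype.card ι ^ m : ℕ) : ℕ∞) := by
        exact_mod_cast this
      simpa using h3
    refine (ENNReal.log_monotone h2).trans (le_of_eq ?_)
    rw [ENNReal.log_pow, ENNReal.log_pos_real (by simpa using hι.ne') (by simp)]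
    simp
  have hm' : (0 : ℝ) < m := by exact_mod_cast hm
  calc ENNReal.log (sepCard T m ε : ENNReal) / (m : EReal)
      ≤ ((m * Real.log (Fintype.card ι) : ℝ) : EReal) / ((m : ℝ) : EReal) :=
        EReal.monotone_div_right_of_nonneg (by exact_mod_cast hm'.le) h1
    _ = _ := by rw [← EReal.coe_div, mul_div_cancel_left₀ _ hm'.ne']

/-- An upper bound for the entropy at every scale gives one for the upper metric mean dimension. -/
theorem upperMDim_le_of_sepEntropy_le (T : X → X) (d K : ℝ)
    (h : ∀ ε : ℝ, 0 < ε → ε < 1 → sepEntropy T ε ≤ ((K + d * |Real.log ε| : ℝ) : EReal)) :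
    upperMDim T ≤ (d : EReal) := by
  have hlog : Tendsto (fun ε : ℝ ↦ |Real.log ε|) (𝓝[>] 0) atTop :=
    tendsto_abs_atBot_atTop.comp Real.tendsto_log_nhdsGT_zero
  have hlim : Tendsto (fun ε : ℝ ↦ ((K / |Real.log ε| + d : ℝ) : EReal)) (𝓝[>] 0) (𝓝 (d : EReal)) := by
    refine (continuous_coe_real_ereal.tendsto _).comp ?_
    simpa using (hlog.const_div_atTop K).add_const d
  rw [← hlim.limsup_eq]
  refine limsup_le_limsup ?_
  filter_upwards [Ioo_mem_nhdsGT (zero_lt_one' ℝ), hlog.eventually_gt_atTop 0] with ε hε hl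
  calc sepEntropy T ε / ((|Real.log ε| : ℝ) : EReal)
      ≤ ((K + d * |Real.log ε| : ℝ) : EReal) / ((|Real.log ε| : ℝ) : EReal) :=
        EReal.monotone_div_right_of_nonneg (by exact_mod_cast hl.le) (h ε hε.1 hε.2)
    _ = _ := by rw [← EReal.coe_div, add_div, mul_div_cancel_right₀ _ hl.ne']

/-- A full shift realised by `T^[q]` with `ε`-separated symbols bounds the entropy from below. -/
theorem le_sepEntropy_of_shift {A : Type*} [Fintype A] [Nonempty A] (T : X → X) {q : ℕ}
    (hq : 0 < q) {ε : ℝ} (hε : 0 < ε) (x : (ℕ → A) → ℕ → X)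
    (hx : ∀ σ k, T^[q] (x σ k) = x σ (k + 1))
    (hsep : ∀ σ σ' k, σ k ≠ σ' k → ε < dist (x σ k) (x σ' k)) :
    ((Real.log (Fintype.card A) / q : ℝ) : EReal) ≤ sepEntropy T ε := by
  have hx' : ∀ σ k, T^[q * k] (x σ 0) = x σ k := by
    intro σ k
    induction k with
    | zero => simp
    | succ k ih => rw [Nat.mul_succ, Nat.add_comm, Function.iterate_add_apply, ih, hx]
  refine le_limsup_of_frequently_le' ?_
  -- A lower bound for the limsup is only needed along the multiples of `q`.
  have ht : Tendsto (fun m : ℕ ↦ q * m) atTop atTop := tendsto_id.const_mul_atTop' hq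
  refine ht.frequently ((eventually_gt_atTop 0).mono fun m hm ↦ ?_).frequently
  -- Finite words are padded by an arbitrary letter; only the first `m` symbols are compared.
  let e : (Fin m → A) → ℕ → A := fun w k ↦ if h : k < m then w ⟨k, h⟩ else Classical.arbitrary A
  let g : (Fin m → A) → X := fun w ↦ x (e w) 0
  have hlt : ∀ w w', w ≠ w' → ε < dynDist T (q * m) (g w) (g w') := by
    intro w w' hne
    obtain ⟨i, hi⟩ := Function.ne_iff.1 hne
    have h1 := hsep (e w) (e w') i (by simpa [e] using hi)
    rw [← hx', ← hx' (e w')] at h1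
    exact h1.trans_le (le_ciSup (f := fun k : Fin (q * m) ↦ dist (T^[k] (g w)) (T^[k] (g w')))
      (Set.finite_range _).bddAbove ⟨q * i, Nat.mul_lt_mul_of_pos_left i.2 hq⟩)
  have hself : ∀ y, dynDist T (q * m) y y = 0 := by intro y; simp [dynDist]
  have hinj : Function.Injective g := by
    intro w w' h
    by_contra hne
    have := hlt w w' hne
    rw [h, hself] at this
    linarith
  have hcard : ((Fintype.card A ^ m : ℕ) : ℕ∞) ≤ sepCard T (q * m) ε := by
    have hs : IsDynSeparated T (q * m) ε (range g) := by
      rintro _ ⟨w, rfl⟩ _ ⟨w', rfl⟩ hne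
      exact hlt w w' fun h ↦ hne (by rw [h])
    refine le_trans (le_of_eq ?_) (le_iSup₂_of_le (range g) hs le_rfl)
    rw [← image_univ, hinj.encard_image]
    simp [encard_univ]
  have hA : 0 < Fintype.card A := Fintype.card_pos
  have h1 : ((m * Real.log (Fintype.card A) : ℝ) : EReal) ≤
      ENNReal.log (sepCard T (q * m) ε : ENNReal) := by
    have h2 : (Fintype.card A : ENNReal) ^ m ≤ ((sepCard T (q * m) ε : ℕ∞) : ENNReal) := by
      have h3 : (((Fintype.card A ^ m : ℕ) : ℕ∞) : ENNReal) ≤ ((sepCard T (q * m) ε : ℕ∞) : ENNReal) := by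
        exact_mod_cast hcard
      simpa using h3
    refine le_trans (le_of_eq ?_) (ENNReal.log_monotone h2)
    rw [ENNReal.log_pow, ENNReal.log_pos_real (by simp) (by simp)]
    simp
  have hm' : (0 : ℝ) < m := by exact_mod_cast hm
  have hq' : (0 : ℝ) < q := by exact_mod_cast hq
  calc ((Real.log (Fintype.card A) / q : ℝ) : EReal)
      = ((m * Real.log (Fintype.card A) : ℝ) : EReal) / ((q * m : ℝ) : EReal) := by
        rw [← EReal.coe_div]
        congr 1
        field_simp
    _ ≤ ENNReal.log (sepCard T (q * m) ε : ENNReal) / ((q * m : ℝ) : EReal) :=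
        EReal.monotone_div_right_of_nonneg (by exact_mod_cast (mul_pos hq' hm').le) h1
    _ = _ := by congr 1; push_cast; rfl

/-- For a limsup it suffices that good scales accumulate at `0`. One `δ` serves both as bound on the
scale and as loss in the dimension, since decreasing it strengthens both. -/
theorem le_upperMDim_of_sepEntropy_ge (T : X → X) (d : ℝ)
    (h : ∀ δ > (0 : ℝ), ∃ ε, 0 < ε ∧ ε < δ ∧
      (((d - δ) * |Real.log ε| : ℝ) : EReal) ≤ sepEntropy T ε) :
    (d : EReal) ≤ upperMDim T := by
  have key : ∀ δ : ℝ, 0 < δ → ((d - δ : ℝ) : EReal) ≤ upperMDim T := by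
    intro δ hδ
    refine le_limsup_of_frequently_le' ?_
    rw [(nhdsGT_basis (0 : ℝ)).frequently_iff]
    intro η hη
    obtain ⟨ε, hε, hεδ, hle⟩ := h (min (min δ η) 1) (by positivity)
    have h1 : ε < δ := hεδ.trans_le ((min_le_left _ _).trans (min_le_left _ _))
    have h2 : ε < η := hεδ.trans_le ((min_le_left _ _).trans (min_le_right _ _))
    have h3 : ε < 1 := hεδ.trans_le (min_le_right _ _)
    refine ⟨ε, ⟨hε, h2⟩, ?_⟩
    have hl : 0 < |Real.log ε| := abs_pos.2 (Real.log_neg hε h3).ne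
    calc ((d - δ : ℝ) : EReal) = (((d - δ) * |Real.log ε| : ℝ) : EReal) / ((|Real.log ε| : ℝ) : EReal) := by
          rw [← EReal.coe_div, mul_div_cancel_right₀ _ hl.ne']
      _ ≤ _ := by
          refine EReal.monotone_div_right_of_nonneg (by exact_mod_cast hl.le) (le_trans ?_ hle)
          rw [EReal.coe_le_coe_iff]
          gcongr
          exact (min_le_left _ _).trans (min_le_left _ _)
  refine le_of_forall_lt fun c hc ↦ ?_
  obtain ⟨r, hcr, hrd⟩ := EReal.lt_iff_exists_real_btwn.1 hc
  have := key (d - r) (by rw [sub_pos]; exact_mod_cast hrd)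
  exact hcr.trans_le (by simpa using this)

end Entropy

variable {n : ℕ} {X : Type*} [MetricSpace X] [ChartedSpace (EuclideanSpace ℝ (Fin n)) X]

/-- The upper metric mean dimension of a self-map of a compact Riemannian manifold is at most the
dimension. -/
theorem LocallyBilipschitzCharts.upperMDim_le [CompactSpace X] [Nonempty X]
    (hX : LocallyBilipschitzCharts n X) (T : X → X) : upperMDim T ≤ ((n : ℝ) : EReal) := by
  obtain ⟨t, C, hC, hf⟩ := hX.exists_partition
  refine upperMDim_le_of_sepEntropy_le T n (Real.log t.card + n * Real.log (C + 1)) fun ε hε hε1 ↦ ?_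
  -- The coarsest mesh for which the pieces have diameter `C / M ≤ ε`.
  let M := ⌈C / ε⌉₊
  have hM : 0 < M := Nat.ceil_pos.2 (by positivity)
  have hM' : (0 : ℝ) < M := by exact_mod_cast hM
  obtain ⟨f, hf⟩ := hf M hM
  refine (sepEntropy_le_of_partition T hε.le f fun y z hyz ↦ (hf y z hyz).trans ?_).trans ?_
  · rw [div_le_iff₀ hM', ← div_le_iff₀' hε]
    exact Nat.le_ceil _
  · rw [EReal.coe_le_coe_iff]
    have ht : (t.card : ℝ) ≠ 0 := by
      have := (f (Classical.arbitrary X)).1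
      exact_mod_cast (Finset.card_pos.2 ⟨_, this.2⟩).ne'
    have h1 : (Fintype.card (t × (Fin n → Fin M)) : ℝ) = t.card * (M : ℝ) ^ n := by simp
    have h2 : (M : ℝ) ≤ (C + 1) / ε := by
      have := (Nat.ceil_lt_add_one (by positivity : 0 ≤ C / ε)).le
      refine this.trans ?_
      rw [add_div]
      gcongr
      rw [le_div_iff₀ hε]
      linarith
    have h3 : Real.log M ≤ Real.log (C + 1) + |Real.log ε| := by
      rw [abs_of_neg (Real.log_neg hε hε1), ← sub_eq_add_neg,
        ← Real.log_div (by positivity) hε.ne']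
      exact Real.log_le_log hM' h2
    rw [h1, Real.log_mul ht (by positivity), Real.log_pow]
    have : (n : ℝ) * Real.log M ≤ n * (Real.log (C + 1) + |Real.log ε|) := by gcongr
    linarith

/-- Since `|log (c / M)| = log M - log c` for large `M`, the claim amounts to `-(n - δ) * log c ≤ δ
* log M`: the constant `c` is absorbed as `M` grows. -/
theorem exists_grid_scale (n : ℕ) {c δ : ℝ} (hc : 0 < c) (hδ : 0 < δ) :
    ∃ M : ℕ, 0 < M ∧ c / M < δ ∧ (n - δ) * |Real.log (c / M)| ≤ n * Real.log M := by
  have hlog : Tendsto (fun M : ℕ ↦ Real.log M) atTop atTop :=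
    Real.tendsto_log_atTop.comp tendsto_natCast_atTop_atTop
  have hdiv : Tendsto (fun M : ℕ ↦ c / (M : ℝ)) atTop (𝓝 0) :=
    tendsto_natCast_atTop_atTop.const_div_atTop c
  obtain ⟨M, h1, h2, h3, h4, h5⟩ := ((eventually_gt_atTop 0).and
    ((hdiv.eventually_lt_const hδ).and ((hdiv.eventually_lt_const one_pos).and
    ((hlog.eventually_ge_atTop (-(n - δ) * Real.log c / δ)).and
      (hlog.eventually_ge_atTop 0))))).exists
  refine ⟨M, h1, h2, ?_⟩
  have hM : (0 : ℝ) < M := by exact_mod_cast h1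
  rw [abs_of_neg (Real.log_neg (by positivity) h3), Real.log_div hc.ne' hM.ne']
  rw [div_le_iff₀ hδ] at h4
  linarith

end

/-! ### Local homeomorphisms, connectedness and uniform limits -/

section

open Set Metric Filter

section EuclideanMoves

variable {E : Type*} [NormedAddCommGroup E] [NormedSpace ℝ E]

/-- A homeomorphism supported in the ball of radius `r` about `y` that translates `y` by `v`. -/
theorem exists_homeomorph_ball [CompleteSpace E] (y v : E) {r : ℝ} (hr : 0 < r) (hv : ‖v‖ < r) :
    ∃ g : E ≃ₜ E, (∀ x ∉ ball y r, g x = x) ∧ g y = y + v := by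
  -- A tent function with Lipschitz constant `1 / r`: `f - id = b • v` has Lipschitz constant `‖v‖ /
  -- r < 1`, so `f` is a homeomorphism.
  let b : E → ℝ := fun x ↦ max 0 (1 - ‖x - y‖ / r)
  let f : E → E := fun x ↦ x + b x • v
  let c : NNReal := ⟨‖v‖ / r, by positivity⟩
  have hc1 : c < 1 := by
    rw [← NNReal.coe_lt_coe]
    exact (div_lt_one hr).2 hv
  have hb : ∀ x x', |b x - b x'| ≤ ‖x - x'‖ / r := by
    intro x x'
    refine (abs_max_sub_max_le_max 0 (1 - ‖x - y‖ / r) 0 (1 - ‖x' - y‖ / r)).trans ?_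
    rw [sub_self, abs_zero, max_eq_right (abs_nonneg _)]
    have h1 : 1 - ‖x - y‖ / r - (1 - ‖x' - y‖ / r) = (‖x' - y‖ - ‖x - y‖) / r := by ring
    rw [h1, abs_div, abs_of_pos hr]
    gcongr
    refine (abs_norm_sub_norm_le _ _).trans (le_of_eq ?_)
    rw [sub_sub_sub_cancel_right, norm_sub_rev]
  have hf : ApproximatesLinearOn f (ContinuousLinearEquiv.refl ℝ E : E →L[ℝ] E) univ c := by
    intro x _ x' _
    have h1 : f x - f x' - (ContinuousLinearEquiv.refl ℝ E : E →L[ℝ] E) (x - x') =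
        (b x - b x') • v := by
      simp only [f, ContinuousLinearEquiv.coe_refl, ContinuousLinearMap.coe_id', id_eq, sub_smul]
      abel
    rw [h1, norm_smul, Real.norm_eq_abs]
    calc |b x - b x'| * ‖v‖ ≤ ‖x - x'‖ / r * ‖v‖ := by gcongr; exact hb x x'
      _ = ‖v‖ / r * ‖x - x'‖ := by ring
  have hN : Subsingleton E ∨
      c < ‖((ContinuousLinearEquiv.refl ℝ E).symm : E →L[ℝ] E)‖₊⁻¹ := by
    rcases subsingleton_or_nontrivial E with h | h
    · exact Or.inl h
    · right
      have : ‖((ContinuousLinearEquiv.refl ℝ E).symm : E →L[ℝ] E)‖₊ = 1 := by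
        rw [← NNReal.coe_inj]
        simp
      rwa [this, inv_one]
  refine ⟨hf.toHomeomorph f hN, fun x hx ↦ ?_, ?_⟩
  · change f x = x
    have : b x = 0 := by
      rw [mem_ball, not_lt, dist_eq_norm] at hx
      exact max_eq_left (by rw [sub_nonpos, le_div_iff₀ hr]; linarith)
    simp [f, this]
  · change f y = y + v
    simp [f, b]

/-- In polar coordinates the annulus is the image of sphere times interval; the rank hypothesis
makes the sphere connected. -/
theorem isPreconnected_annulus (h : 1 < Module.rank ℝ E) (c : E) {a b : ℝ} (ha : 0 ≤ a) :
    IsPreconnected {x : E | a < dist x c ∧ dist x c < b} := by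
  have h1 : {x : E | a < dist x c ∧ dist x c < b} =
      (fun p : E × ℝ ↦ c + p.2 • p.1) '' (sphere (0 : E) 1 ×ˢ Ioo a b) := by
    ext x
    simp only [mem_ofPred_eq, mem_image, mem_prod, mem_sphere_zero_iff_norm, mem_Ioo, Prod.exists]
    constructor
    · rintro ⟨h1, h2⟩
      have h3 : 0 < ‖x - c‖ := by rw [← dist_eq_norm]; exact ha.trans_lt h1
      refine ⟨‖x - c‖⁻¹ • (x - c), ‖x - c‖, ⟨?_, ?_⟩, ?_⟩
      · rw [norm_smul, norm_inv, norm_norm, inv_mul_cancel₀ h3.ne']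
      · rwa [← dist_eq_norm, and_iff_left h2]
      · rw [smul_smul, mul_inv_cancel₀ h3.ne', one_smul, add_sub_cancel]
    · rintro ⟨u, t, ⟨hu, ht⟩, rfl⟩
      have : dist (c + t • u) c = t := by
        rw [dist_eq_norm, add_sub_cancel_left, norm_smul, hu, mul_one, Real.norm_eq_abs,
          abs_of_pos (ha.trans_lt ht.1)]
      rwa [this]
  rw [h1]
  exact ((isPreconnected_sphere h 0 1).prod isPreconnected_Ioo).image _ (by fun_prop)

end EuclideanMoves

section ChartMoves

variable {X E : Type*} [TopologicalSpace X] [T2Space X] [TopologicalSpace E]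

open Classical in
/-- The extension by the identity of a self-map of the target of a chart. -/
def extendById (φ : OpenPartialHomeomorph X E) (g : E → E) (x : X) : X :=
  if x ∈ φ.source then φ.symm (g (φ x)) else x

/-- Outside the chart the map is locally the identity, because the compact set `φ.symm '' K` is
closed in the Hausdorff space `X`. -/
theorem continuous_extendById (φ : OpenPartialHomeomorph X E) {g : E → E} (hg : Continuous g)
    {K : Set E} (hK : IsCompact K) (hKt : K ⊆ φ.target) (hgK : MapsTo g K K)
    (hid : ∀ x ∉ K, g x = x) : Continuous (extendById φ g) := by
  have hmap : MapsTo g φ.target φ.target := by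
    intro x hx
    by_cases hxK : x ∈ K
    · exact hKt (hgK hxK)
    · rwa [hid x hxK]
  rw [continuous_iff_continuousAt]
  intro x
  by_cases hx : x ∈ φ.source
  · have h1 : extendById φ g =ᶠ[𝓝 x] fun x ↦ φ.symm (g (φ x)) := by
      filter_upwards [φ.open_source.mem_nhds hx] with z hz
      simp [extendById, hz]
    refine ContinuousAt.congr ?_ h1.symm
    exact (φ.continuousAt_symm (hmap (φ.map_source hx))).comp (f := fun x ↦ g (φ x))
      ((hg.continuousAt (x := φ x)).comp (φ.continuousAt hx))
  · have hc : IsClosed (φ.symm '' K) :=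
      (hK.image_of_continuousOn (φ.continuousOn_symm.mono hKt)).isClosed
    have hxK : x ∉ φ.symm '' K := by
      rintro ⟨z, hz, rfl⟩
      exact hx (φ.map_target (hKt hz))
    have h1 : extendById φ g =ᶠ[𝓝 x] id := by
      filter_upwards [hc.isOpen_compl.mem_nhds hxK] with z hz
      by_cases hzs : z ∈ φ.source
      · have : φ z ∉ K := fun h ↦ hz ⟨_, h, φ.left_inv hzs⟩
        simp [extendById, hzs, hid _ this]
      · simp [extendById, hzs]
    exact continuousAt_id.congr h1.symm

theorem exists_homeomorph_extendById (φ : OpenPartialHomeomorph X E) (g : E ≃ₜ E)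
    {K : Set E} (hK : IsCompact K) (hKt : K ⊆ φ.target) (hid : ∀ x ∉ K, g x = x) :
    ∃ h : X ≃ₜ X, ∀ x, h x = extendById φ g x := by
  have hid' : ∀ x ∉ K, g.symm x = x := fun x hx ↦ by
    rw [Homeomorph.symm_apply_eq, hid x hx]
  have hgK : MapsTo g K K := by
    intro x hx
    by_contra hn
    exact hn (by rwa [g.injective (hid _ hn)])
  have hgK' : MapsTo g.symm K K := by
    intro x hx
    by_contra hn
    exact hn (by rwa [g.symm.injective (hid' _ hn)])
  have hmap : ∀ x ∈ φ.target, g x ∈ φ.target := by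
    intro x hx
    by_cases hxK : x ∈ K
    · exact hKt (hgK hxK)
    · rwa [hid x hxK]
  have hmap' : ∀ x ∈ φ.target, g.symm x ∈ φ.target := by
    intro x hx
    by_cases hxK : x ∈ K
    · exact hKt (hgK' hxK)
    · rwa [hid' x hxK]
  refine ⟨⟨⟨extendById φ g, extendById φ g.symm, ?_, ?_⟩,
    continuous_extendById φ g.continuous hK hKt hgK hid,
    continuous_extendById φ g.symm.continuous hK hKt hgK' hid'⟩, fun x ↦ rfl⟩
  · intro x
    by_cases hx : x ∈ φ.source
    · have h1 := hmap _ (φ.map_source hx)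
      simp [extendById, hx, φ.map_target h1, φ.right_inv h1]
    · simp [extendById, hx]
  · intro x
    by_cases hx : x ∈ φ.source
    · have h1 := hmap' _ (φ.map_source hx)
      simp [extendById, hx, φ.map_target h1, φ.right_inv h1]
    · simp [extendById, hx]

end ChartMoves

section Connected

variable {X : Type*} [TopologicalSpace X] [T1Space X]

/-- In a separation of `U \ {s}`, the connected set `N \ {s}` lies on one side; adding `N` to that
side would separate `U`. -/
theorem isPreconnected_diff_singleton {U : Set X} (hU : IsPreconnected U) {s : X} {N : Set X}
    (hN : IsOpen N) (hsN : s ∈ N) (hNU : N ⊆ U) (hNs : IsPreconnected (N \ {s})) :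
    IsPreconnected (U \ {s}) := by
  have key : ∀ u v : Set X, IsOpen u → IsOpen v → U \ {s} ⊆ u ∪ v → ((U \ {s}) ∩ v).Nonempty →
      N \ {s} ⊆ u → ((U \ {s}) ∩ (u ∩ v)).Nonempty := by
    intro u v hu hv huv hne hNu
    obtain ⟨z, hz, hzv⟩ := hne
    obtain ⟨x, hxU, hxu, hxv, hxs⟩ := hU (u ∪ N) (v \ {s}) (hu.union hN)
      (hv.sdiff isClosed_singleton)
      (fun x hx ↦ by
        by_cases hxs : x = s
        · exact Or.inl (Or.inr (hxs ▸ hsN))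
        · rcases huv ⟨hx, hxs⟩ with h | h
          · exact Or.inl (Or.inl h)
          · exact Or.inr ⟨h, hxs⟩)
      ⟨s, hNU hsN, Or.inr hsN⟩ ⟨z, hz.1, hzv, hz.2⟩
    refine ⟨x, ⟨hxU, hxs⟩, ?_, hxv⟩
    rcases hxu with h | h
    · exact h
    · exact hNu ⟨h, hxs⟩
  intro u v hu hv huv hneu hnev
  by_contra hcon
  have hempty : (N \ {s}) ∩ (u ∩ v) = ∅ := by
    rw [← not_nonempty_iff_eq_empty]
    rintro ⟨x, hx, hxuv⟩
    exact hcon ⟨x, ⟨hNU hx.1, hx.2⟩, hxuv⟩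
  rcases isPreconnected_iff_subset_of_disjoint.1 hNs u v hu hv
    ((sdiff_subset_sdiff_left hNU).trans huv) hempty with h | h
  · exact hcon (key u v hu hv huv hnev h)
  · rw [inter_comm u v] at hcon
    exact hcon (key v u hv hu (by rwa [union_comm]) hneu h)

end Connected

section Limit

variable {X : Type*} [MetricSpace X] [CompleteSpace X]

theorem exists_tendstoUniformly_of_summable (g : ℕ → X → X) (hg : ∀ j, Continuous (g j))
    (δ : ℕ → ℝ) (hδ : Summable δ) (h : ∀ j x, dist (g j x) (g (j + 1) x) ≤ δ j) :
    ∃ f : X → X, Continuous f ∧ TendstoUniformly g f atTop := by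
  have hc : ∀ x, ∃ y, Tendsto (fun j ↦ g j x) atTop (𝓝 y) := fun x ↦
    cauchySeq_tendsto_of_complete (cauchySeq_of_dist_le_of_summable δ (fun j ↦ h j x) hδ)
  choose f hf using hc
  have hu : TendstoUniformly g f atTop := by
    rw [Metric.tendstoUniformly_iff]
    intro ε hε
    filter_upwards [(tendsto_sum_nat_add δ).eventually_lt_const hε] with j hj x
    rw [dist_comm]
    refine (dist_le_tsum_of_dist_le_of_tendsto δ (fun j ↦ h j x) hδ (hf x) j).trans_lt ?_
    simpa only [add_comm] using hj
  exact ⟨f, hu.continuous (Frequently.of_forall hg), hu⟩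

/-- A sequence of homeomorphisms which, together with the inverses, has summable uniform increments
converges uniformly to a homeomorphism. -/
theorem exists_homeomorph_tendstoUniformly (G : ℕ → X ≃ₜ X) (δ : ℕ → ℝ) (hδ : Summable δ)
    (h : ∀ j x, dist (G j x) (G (j + 1) x) ≤ δ j)
    (h' : ∀ j x, dist ((G j).symm x) ((G (j + 1)).symm x) ≤ δ j) :
    ∃ F : X ≃ₜ X, TendstoUniformly (fun j x ↦ G j x) F atTop := by
  obtain ⟨f, hfc, hf⟩ := exists_tendstoUniformly_of_summable (fun j x ↦ G j x)
    (fun j ↦ (G j).continuous) δ hδ h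
  obtain ⟨f', hfc', hf'⟩ := exists_tendstoUniformly_of_summable (fun j x ↦ (G j).symm x)
    (fun j ↦ (G j).symm.continuous) δ hδ h'
  -- Uniform convergence allows passing to the limit in both compositions, so the two limits are
  -- mutually inverse.
  refine ⟨⟨⟨f, f', fun x ↦ ?_, fun x ↦ ?_⟩, hfc, hfc'⟩, hf⟩
  · have := hf'.tendsto_comp hfc'.continuousAt (hf.tendsto_at x)
    simp only [Homeomorph.symm_apply_apply] at this
    exact tendsto_nhds_unique this tendsto_const_nhds
  · have := hf.tendsto_comp hfc.continuousAt (hf'.tendsto_at x)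
    simp only [Homeomorph.apply_symm_apply] at this
    exact tendsto_nhds_unique this tendsto_const_nhds

end Limit

end

/-! ### Moving finitely many points in a manifold of dimension at least two -/

section

open Set Metric Filter

section MovesWithin

variable {X : Type*} [TopologicalSpace X] {ι : Type*} {O : ι → Set X}

/-- The homeomorphism `k` only moves points within the sets `O i`. -/
def MovesWithin (O : ι → Set X) (k : X ≃ₜ X) : Prop :=
  ∀ x, k x = x ∨ ∃ i, x ∈ O i ∧ k x ∈ O i

theorem MovesWithin.refl (O : ι → Set X) : MovesWithin O (Homeomorph.refl X) := fun _ ↦ Or.inl rfl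

theorem MovesWithin.mem_iff {k : X ≃ₜ X} (hk : MovesWithin O k) (hO : Pairwise (Function.onFun Disjoint O))
    (x : X) (i : ι) : k x ∈ O i ↔ x ∈ O i := by
  rcases hk x with h | ⟨j, hj, hj'⟩
  · rw [h]
  · constructor
    · intro hi
      rwa [hO.eq (not_disjoint_iff.2 ⟨_, hi, hj'⟩)]
    · intro hi
      rwa [hO.eq (not_disjoint_iff.2 ⟨_, hi, hj⟩)]

theorem MovesWithin.trans {k l : X ≃ₜ X} (hk : MovesWithin O k) (hl : MovesWithin O l)
    (hO : Pairwise (Function.onFun Disjoint O)) : MovesWithin O (k.trans l) := by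
  intro x
  rcases hk x with h | ⟨i, hi, hi'⟩
  · simpa [h] using hl x
  · exact Or.inr ⟨i, hi, (hl.mem_iff hO _ i).2 hi'⟩

theorem MovesWithin.mono {κ : Type*} {O' : κ → Set X} {k : X ≃ₜ X} (hk : MovesWithin O k)
    (h : ∀ i, ∃ j, O i ⊆ O' j) : MovesWithin O' k := by
  intro x
  rcases hk x with h' | ⟨i, hi, hi'⟩
  · exact Or.inl h'
  · obtain ⟨j, hj⟩ := h i
    exact Or.inr ⟨j, hj hi, hj hi'⟩

theorem mem_of_forall_notMem_eq {U : Set X} {h : X ≃ₜ X} (hU : ∀ x ∉ U, h x = x) {x : X}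
    (hx : x ∈ U) : h x ∈ U := by
  by_contra hn
  exact hn (by rwa [h.injective (hU _ hn)])

theorem mem_iff_of_forall_notMem_eq {U : Set X} {h : X ≃ₜ X} (hU : ∀ x ∉ U, h x = x) {x : X} :
    h x ∈ U ↔ x ∈ U := by
  refine ⟨fun hx ↦ ?_, mem_of_forall_notMem_eq hU⟩
  by_contra hn
  exact hn (by rwa [hU x hn] at hx)

end MovesWithin

variable {n : ℕ} {X : Type*} [TopologicalSpace X] [ChartedSpace (EuclideanSpace ℝ (Fin n)) X]

theorem one_lt_rank_euclideanSpace (hn : 2 ≤ n) :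
    1 < Module.rank ℝ (EuclideanSpace ℝ (Fin n)) := by
  apply Module.one_lt_rank_of_one_lt_finrank
  rw [finrank_euclideanSpace_fin]
  omega

variable (n) in
theorem exists_closedBall_subset_chart (y : X) {U : Set X} (hU : U ∈ 𝓝 y) :
    ∃ r > 0, closedBall (chartAt (EuclideanSpace ℝ (Fin n)) y y) r ⊆
      (chartAt (EuclideanSpace ℝ (Fin n)) y).target ∩
        (chartAt (EuclideanSpace ℝ (Fin n)) y).symm ⁻¹' U := by
  set φ := chartAt (EuclideanSpace ℝ (Fin n)) y
  have hy : y ∈ φ.source := mem_chart_source _ y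
  have hN : φ.target ∩ φ.symm ⁻¹' U ∈ 𝓝 (φ y) := by
    refine Filter.inter_mem (φ.open_target.mem_nhds (φ.map_source hy)) ?_
    apply (φ.continuousAt_symm (φ.map_source hy)).preimage_mem_nhds
    rwa [φ.left_inv hy]
  exact Metric.nhds_basis_closedBall.mem_iff.1 hN

/-- The image in `X` of a round annulus of the preferred chart at `p`. -/
def chartAnnulus (n : ℕ) {X : Type*} [TopologicalSpace X]
    [ChartedSpace (EuclideanSpace ℝ (Fin n)) X] (p : X) (a b : ℝ) : Set X :=
  (chartAt (EuclideanSpace ℝ (Fin n)) p).source ∩ chartAt (EuclideanSpace ℝ (Fin n)) p ⁻¹'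
    {x | a < dist x (chartAt (EuclideanSpace ℝ (Fin n)) p p) ∧
      dist x (chartAt (EuclideanSpace ℝ (Fin n)) p p) < b}

theorem isOpen_chartAnnulus (p : X) (a b : ℝ) : IsOpen (chartAnnulus n p a b) := by
  refine (chartAt (EuclideanSpace ℝ (Fin n)) p).isOpen_inter_preimage ?_
  have hc : Continuous fun x : EuclideanSpace ℝ (Fin n) ↦
      dist x (chartAt (EuclideanSpace ℝ (Fin n)) p p) := by fun_prop
  exact (isOpen_lt continuous_const hc).inter (isOpen_lt hc continuous_const)

theorem isPreconnected_chartAnnulus (hn : 2 ≤ n) (p : X) {a b : ℝ} (ha : 0 ≤ a)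
    (hb : ball (chartAt (EuclideanSpace ℝ (Fin n)) p p) b ⊆
      (chartAt (EuclideanSpace ℝ (Fin n)) p).target) : IsPreconnected (chartAnnulus n p a b) := by
  set φ := chartAt (EuclideanSpace ℝ (Fin n)) p with hφ
  have h1 : chartAnnulus n p a b = φ.symm '' {x | a < dist x (φ p) ∧ dist x (φ p) < b} := by
    rw [φ.symm_image_eq_source_inter_preimage fun x hx ↦ hb hx.2]
    rfl
  rw [h1]
  exact (isPreconnected_annulus (one_lt_rank_euclideanSpace hn) (φ p) ha).image _
    (φ.continuousOn_symm.mono fun x hx ↦ hb hx.2)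

/-- Any two points of a connected open subset `U` of a manifold are exchanged by a homeomorphism
supported in `U`. -/
theorem exists_homeomorph_move (n : ℕ) {X : Type*} [TopologicalSpace X] [T2Space X]
    [ChartedSpace (EuclideanSpace ℝ (Fin n)) X] {U : Set X} (hU : IsOpen U) (hUc : IsPreconnected U) {y z : X}
    (hy : y ∈ U) (hz : z ∈ U) : ∃ h : X ≃ₜ X, (∀ x ∉ U, h x = x) ∧ h y = z := by
  refine hUc.induction₂ (fun y z ↦ ∃ h : X ≃ₜ X, (∀ x ∉ U, h x = x) ∧ h y = z) ?_ ?_ ?_ hy hz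
  · intro y hy
    obtain ⟨r, hr, hrU⟩ := exists_closedBall_subset_chart n y (hU.mem_nhds hy)
    set φ := chartAt (EuclideanSpace ℝ (Fin n)) y
    have hys : y ∈ φ.source := mem_chart_source _ y
    refine nhdsWithin_le_nhds ?_
    filter_upwards [φ.open_source.mem_nhds hys,
      (φ.continuousAt hys).preimage_mem_nhds (ball_mem_nhds _ hr)] with z hzs hz
    obtain ⟨g, hg, hgy⟩ := exists_homeomorph_ball (φ y) (φ z - φ y) hr
      (by rwa [← dist_eq_norm])
    obtain ⟨h, hh⟩ := exists_homeomorph_extendById φ g (isCompact_closedBall (φ y) r)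
      (fun x hx ↦ (hrU hx).1) (fun x hx ↦ hg x fun hb ↦ hx (ball_subset_closedBall hb))
    refine ⟨h, fun x hx ↦ ?_, ?_⟩
    · rw [hh, extendById]
      split_ifs with hxs
      · rw [hg, φ.left_inv hxs]
        intro hb
        have := (hrU (ball_subset_closedBall hb)).2
        rw [mem_preimage, φ.left_inv hxs] at this
        exact hx this
      · rfl
    · rw [hh, extendById, if_pos hys, hgy, add_sub_cancel, φ.left_inv hzs]
  · rintro x y z - - - ⟨h, hh, hxy⟩ ⟨k, hk, hyz⟩
    exact ⟨h.trans k, fun w hw ↦ by simp [hh w hw, hk w hw], by simp [hxy, hyz]⟩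
  · rintro x y - - ⟨h, hh, hxy⟩
    exact ⟨h.symm, fun w hw ↦ by rw [Homeomorph.symm_apply_eq, hh w hw],
      by rw [Homeomorph.symm_apply_eq, hxy]⟩

variable [T2Space X]

/-- Removing finitely many points from a connected open set of a manifold of dimension at least two
leaves it connected. -/
theorem isPreconnected_diff_finite (hn : 2 ≤ n) {U : Set X} (hU : IsOpen U)
    (hUc : IsPreconnected U) {F : Set X} (hF : F.Finite) : IsPreconnected (U \ F) := by
  induction F, hF using Set.Finite.induction_on with
  | empty => simpa
  | @insert s F _ hF ih =>
    rw [insert_eq, union_comm, ← sdiff_sdiff]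
    have hUo : IsOpen (U \ F) := hU.sdiff hF.isClosed
    by_cases hs : s ∈ U \ F
    · obtain ⟨r, hr, hrU⟩ := exists_closedBall_subset_chart n s (hUo.mem_nhds hs)
      set φ := chartAt (EuclideanSpace ℝ (Fin n)) s with hφ
      have hsφ : s ∈ φ.source := mem_chart_source _ s
      have hbt : ball (φ s) r ⊆ φ.target := fun x hx ↦ (hrU (ball_subset_closedBall hx)).1
      refine isPreconnected_diff_singleton ih (N := φ.source ∩ φ ⁻¹' ball (φ s) r)
        (φ.isOpen_inter_preimage isOpen_ball) ⟨hsφ, mem_ball_self hr⟩ ?_ ?_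
      · rintro x ⟨hx, hxb⟩
        have := (hrU (ball_subset_closedBall hxb)).2
        rwa [mem_preimage, φ.left_inv hx] at this
      · convert isPreconnected_chartAnnulus hn s (le_refl 0) hbt using 1
        ext x
        simp only [chartAnnulus, ← hφ, Set.mem_sdiff, mem_inter_iff, mem_preimage, mem_ball,
          mem_singleton_iff, mem_ofPred_eq, dist_pos]
        constructor
        · rintro ⟨⟨hx, hxr⟩, hxs⟩
          exact ⟨hx, fun h ↦ hxs (φ.injOn hx hsφ h), hxr⟩
        · rintro ⟨hx, hxs, hxr⟩
          exact ⟨⟨hx, hxr⟩, fun h ↦ hxs (by rw [h])⟩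
    · rwa [sdiff_singleton_eq_self hs]

/-- Finitely many points lying in disjoint connected open sets can be moved to arbitrary positions
within these sets. -/
theorem exists_homeomorph_move_finite (hn : 2 ≤ n) {ι κ : Type*} [Finite κ] {O : ι → Set X}
    (hOo : ∀ i, IsOpen (O i)) (hOc : ∀ i, IsPreconnected (O i)) (hOd : Pairwise (Function.onFun Disjoint O))
    (c : κ → ι) {y t : κ → X} (hyi : Function.Injective y) (hti : Function.Injective t)
    (hy : ∀ w, y w ∈ O (c w)) (ht : ∀ w, t w ∈ O (c w)) :
    ∃ k : X ≃ₜ X, MovesWithin O k ∧ ∀ w, k (y w) = t w := by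
  suffices H : ∀ s : Set κ, s.Finite → ∃ k : X ≃ₜ X, MovesWithin O k ∧ ∀ w ∈ s, k (y w) = t w by
    obtain ⟨k, hk, hk'⟩ := H univ finite_univ
    exact ⟨k, hk, fun w ↦ hk' w (mem_univ _)⟩
  intro s hs
  induction s, hs using Set.Finite.induction_on with
  | empty => exact ⟨Homeomorph.refl X, MovesWithin.refl O, by simp⟩
  | @insert w s hws hs ih =>
    obtain ⟨k, hk, hk'⟩ := ih
    have hfin : (t '' s).Finite := hs.image t
    -- The targets already reached are removed from the support, so that the new move does not
    -- disturb them; what remains is still connected.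
    obtain ⟨h, hh, hh'⟩ := exists_homeomorph_move n (U := O (c w) \ t '' s)
      ((hOo _).sdiff hfin.isClosed) (isPreconnected_diff_finite hn (hOo _) (hOc _) hfin)
      (y := k (y w)) (z := t w)
      ⟨(hk.mem_iff hOd _ _).2 (hy w), by
        rintro ⟨v, hv, hvw⟩
        rw [← hk' v hv] at hvw
        exact hws (hyi (k.injective hvw) ▸ hv)⟩
      ⟨ht w, by
        rintro ⟨v, hv, hvw⟩
        exact hws (hti hvw ▸ hv)⟩
    have hm : MovesWithin O h := by
      intro x
      by_cases hx : x ∈ O (c w) \ t '' s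
      · exact Or.inr ⟨c w, hx.1, (mem_of_forall_notMem_eq hh hx).1⟩
      · exact Or.inl (hh x hx)
    refine ⟨k.trans h, hk.trans hm hOd, ?_⟩
    rintro v (rfl | hv)
    · simpa using hh'
    · simp only [Homeomorph.trans_apply, hk' v hv]
      exact hh _ fun hx ↦ hx.2 ⟨v, hv, rfl⟩

end

/-! ### De Bruijn families and their refinement -/

section

open Set Metric Filter

variable {n : ℕ} {X : Type*} [MetricSpace X] [ChartedSpace (EuclideanSpace ℝ (Fin n)) X]

theorem infinite_of_isOpen_manifold (n : ℕ) (hn : 2 ≤ n) {X : Type*} [TopologicalSpace X]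
    [ChartedSpace (EuclideanSpace ℝ (Fin n)) X] {U : Set X}
    (hU : IsOpen U) (hne : U.Nonempty) : U.Infinite := by
  obtain ⟨y, hy⟩ := hne
  obtain ⟨r, hr, hrU⟩ := exists_closedBall_subset_chart n y (hU.mem_nhds hy)
  have : Nontrivial (EuclideanSpace ℝ (Fin n)) :=
    rank_pos_iff_nontrivial.1 (zero_lt_one.trans (one_lt_rank_euclideanSpace hn))
  have hinf : (closedBall (chartAt (EuclideanSpace ℝ (Fin n)) y y) r).Infinite := by
    have := Module.punctured_nhds_neBot ℝ (EuclideanSpace ℝ (Fin n))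
      (chartAt (EuclideanSpace ℝ (Fin n)) y y)
    exact infinite_of_mem_nhds _ (closedBall_mem_nhds _ hr)
  have hinj : InjOn (chartAt (EuclideanSpace ℝ (Fin n)) y).symm
      (closedBall (chartAt (EuclideanSpace ℝ (Fin n)) y y) r) :=
    (chartAt (EuclideanSpace ℝ (Fin n)) y).symm.injOn.mono fun x hx ↦ (hrU hx).1
  exact (hinf.image hinj).mono (image_subset_iff.2 fun x hx ↦ (hrU hx).2)

/-- Numbering `κ` once and using the number of `w` as index in `S (c w)` separates points of the
same set; disjointness separates the others. -/
theorem exists_injective_mem_of_infinite {α ι κ : Type*} [Finite κ] {S : ι → Set α}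
    (hS : ∀ i, (S i).Infinite) (hd : Pairwise (Function.onFun Disjoint S)) (c : κ → ι) :
    ∃ e : κ → α, Function.Injective e ∧ ∀ w, e w ∈ S (c w) := by
  obtain ⟨m, ⟨φ⟩⟩ := Finite.exists_equiv_fin κ
  let g : ∀ i, ℕ ↪ S i := fun i ↦ haveI := (hS i).to_subtype; Infinite.natEmbedding (S i)
  refine ⟨fun w ↦ g (c w) (φ w), fun v w h ↦ ?_, fun w ↦ (g (c w) (φ w)).2⟩
  have hc : c v = c w := by
    refine hd.eq (not_disjoint_iff.2 ⟨_, (g (c v) (φ v)).2, ?_⟩)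
    rw [show ((g (c v) (φ v) : S (c v)) : α) = g (c w) (φ w) from h]
    exact (g (c w) (φ w)).2
  dsimp only at h
  rw [hc] at h
  exact φ.injective (Fin.ext ((g (c w)).injective (Subtype.ext h)))

theorem exists_isOpen_isPreconnected_mem (n : ℕ) {X : Type*} [TopologicalSpace X]
    [ChartedSpace (EuclideanSpace ℝ (Fin n)) X] {x : X} {N : Set X} (hN : N ∈ 𝓝 x) :
    ∃ V, IsOpen V ∧ IsPreconnected V ∧ x ∈ V ∧ V ⊆ N := by
  have := ChartedSpace.locallyConnectedSpace (EuclideanSpace ℝ (Fin n)) X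
  obtain ⟨V, ⟨h1, h2, h3⟩, h4⟩ := (LocallyConnectedSpace.open_connected_basis x).mem_iff.1 hN
  exact ⟨V, h1, h3.isPreconnected, h2, h4⟩

/-- Disjoint connected open sets `O u` indexed by the words of length `L` in the alphabet `A`,
such that `G` maps some point of `O u` to `O v` whenever `u`, `v` are consecutive factors of a
word of length `L + 1`. -/
structure IsDeBruijnFamily {A : Type*} {L : ℕ} (G : X ≃ₜ X) (O : (Fin L → A) → Set X) : Prop where
  isOpen : ∀ u, IsOpen (O u)
  isPreconnected : ∀ u, IsPreconnected (O u)
  disjoint : Pairwise (Function.onFun Disjoint O)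
  exists_mem : ∀ v : Fin (L + 1) → A, ∃ x ∈ O (Fin.init v), G x ∈ O (Fin.tail v)

/-- Refinement of a de Bruijn family to longer words, with control on the sizes of the new sets and
of their preimages. -/
theorem IsDeBruijnFamily.exists_refinement (hn : 2 ≤ n) {A : Type*} [Finite A] {L : ℕ} {G : X ≃ₜ X}
    {O : (Fin L → A) → Set X} (h : IsDeBruijnFamily G O) {D : (Fin (L + 1) → A) → Set X}
    (hDo : ∀ v, IsOpen (D v)) (hDc : ∀ v, IsPreconnected (D v)) (hDne : ∀ v, (D v).Nonempty)
    (hDd : Pairwise (Function.onFun Disjoint D)) (hD : ∀ v, ∀ x ∈ D v, x ∈ O (Fin.init v))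
    (hGD : ∀ v, ∀ x ∈ D v, G x ∈ O (Fin.tail v)) :
    ∃ (k : X ≃ₜ X) (O' : (Fin (L + 2) → A) → Set X), MovesWithin O k ∧
      IsDeBruijnFamily (G.trans k) O' ∧ (∀ u, ∀ x ∈ O' u, x ∈ D (Fin.tail u)) ∧
      ∀ u, ∀ x, k (G x) ∈ O' u → x ∈ D (Fin.init u) := by
  -- `G` maps `D (init u)` into the set `O` of the middle word of `u`, which also contains `D (tail
  -- u)`; so points can be moved from one to the other within `O`.
  have hcomm : ∀ {m : ℕ} (u : Fin (m + 2) → A), Fin.tail (Fin.init u) = Fin.init (Fin.tail u) :=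
    fun u ↦ rfl
  have hDi : ∀ v, (D v).Infinite := fun v ↦ infinite_of_isOpen_manifold n hn (hDo v) (hDne v)
  have hGi : ∀ v, (G '' D v).Infinite := fun v ↦ (hDi v).image G.injective.injOn
  have hGd : Pairwise (Function.onFun Disjoint fun v ↦ G '' D v) := fun v w hvw ↦
    (disjoint_image_iff G.injective).2 (hDd hvw)
  obtain ⟨y, hyi, hy⟩ := exists_injective_mem_of_infinite hGi hGd
    (fun u : Fin (L + 2) → A ↦ (Fin.init u : Fin (L + 1) → A))
  obtain ⟨q, hqi, hq⟩ := exists_injective_mem_of_infinite hDi hDd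
    (fun u : Fin (L + 2) → A ↦ (Fin.tail u : Fin (L + 1) → A))
  obtain ⟨k₁, hk₁, hk₁y⟩ := exists_homeomorph_move_finite hn h.isOpen h.isPreconnected h.disjoint
    (fun u : Fin (L + 2) → A ↦ Fin.init (Fin.tail u)) hyi hqi
    (fun u ↦ by
      obtain ⟨x, hx, hxy⟩ := hy u
      rw [← hxy]
      exact hGD _ x hx)
    (fun u ↦ hD _ _ (hq u))
  -- After `k₁`, `q u` lies in `D (tail u) ∩ E (init u)`. The new sets are chosen there, so they
  -- control both position and preimage.
  let E : (Fin (L + 1) → A) → Set X := fun v ↦ G.trans k₁ '' D v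
  have hEo : ∀ v, IsOpen (E v) := fun v ↦ (G.trans k₁).isOpen_image.2 (hDo v)
  have hEc : ∀ v, IsPreconnected (E v) := fun v ↦
    (hDc v).image _ (G.trans k₁).continuous.continuousOn
  have hEd : Pairwise (Function.onFun Disjoint E) := fun v w hvw ↦
    (disjoint_image_iff (G.trans k₁).injective).2 (hDd hvw)
  have hqE : ∀ u, q u ∈ E (Fin.init u) := by
    intro u
    obtain ⟨x, hx, hxy⟩ := hy u
    exact ⟨x, hx, by rw [← hk₁y, ← hxy]; rfl⟩
  obtain ⟨U, hU, hUd⟩ := (finite_range q).t2_separation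
  have hO' : ∀ u, ∃ V, IsOpen V ∧ IsPreconnected V ∧ q u ∈ V ∧
      V ⊆ U (q u) ∩ D (Fin.tail u) ∩ E (Fin.init u) := fun u ↦
    exists_isOpen_isPreconnected_mem n ((((hU _).2.inter (hDo _)).inter (hEo _)).mem_nhds
      ⟨⟨(hU _).1, hq u⟩, hqE u⟩)
  choose O' hO'o hO'c hqO' hO' using hO'
  have hO'd : Pairwise (Function.onFun Disjoint O') := fun u v huv ↦
    (hUd (mem_range_self u) (mem_range_self v) (hqi.ne huv)).mono
      (fun x hx ↦ (hO' u hx).1.1) (fun x hx ↦ (hO' v hx).1.1)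
  have hO'i : ∀ u, (O' u).Infinite := fun u ↦
    infinite_of_isOpen_manifold n hn (hO'o u) ⟨_, hqO' u⟩
  obtain ⟨e, hei, he⟩ := exists_injective_mem_of_infinite hO'i hO'd
    (fun w : Fin (L + 3) → A ↦ (Fin.init w : Fin (L + 2) → A))
  obtain ⟨t, hti, ht⟩ := exists_injective_mem_of_infinite hO'i hO'd
    (fun w : Fin (L + 3) → A ↦ (Fin.tail w : Fin (L + 2) → A))
  -- The second move creates the transitions between the new sets. It respects every `E v`, and so
  -- keeps the preimages of the new sets inside the sets `D`.
  obtain ⟨k₂, hk₂, hk₂e⟩ := exists_homeomorph_move_finite hn hEo hEc hEd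
    (fun w : Fin (L + 3) → A ↦ (Fin.init (Fin.tail w) : Fin (L + 1) → A))
    ((G.trans k₁).injective.comp hei) hti
    (fun w ↦ ⟨e w, (hO' _ (he w)).1.2, rfl⟩)
    (fun w ↦ (hO' _ (ht w)).2)
  have hk₂' : MovesWithin O k₂ := by
    refine hk₂.mono fun v ↦ ⟨Fin.tail v, ?_⟩
    rintro _ ⟨x, hx, rfl⟩
    exact (hk₁.mem_iff h.disjoint _ _).2 (hGD _ _ hx)
  refine ⟨k₁.trans k₂, O', hk₁.trans hk₂' h.disjoint, ⟨hO'o, hO'c, hO'd, fun w ↦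
    ⟨e w, he w, ?_⟩⟩, fun u x hx ↦ (hO' u hx).1.2, fun u x hx ↦ ?_⟩
  · have := hk₂e w
    have h2 := ht w
    rw [← this] at h2
    exact h2
  · have h1 : k₂ (k₁ (G x)) ∈ E (Fin.init u) := (hO' u hx).2
    rw [hk₂.mem_iff hEd] at h1
    obtain ⟨x', hx', hxx⟩ := h1
    rwa [← (G.trans k₁).injective hxx]

/-- Length at least two is essential: one-letter words all have empty `init` and `tail`. Hence
refining the family for the empty word requires disjoint sets `D` supplied from outside. -/
theorem init_tail_ext {A : Type*} {m : ℕ} {v v' : Fin (m + 2) → A} (h : Fin.init v = Fin.init v')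
    (h' : Fin.tail v = Fin.tail v') : v = v' := by
  funext i
  refine Fin.cases ?_ (fun i ↦ congrFun h' i) i
  exact congrFun h 0

/-- Sets of a de Bruijn family for nonempty words can be refined to arbitrarily small ones. -/
theorem IsDeBruijnFamily.exists_small_refinement (hn : 2 ≤ n) {A : Type*} [Finite A] {m : ℕ}
    {G : X ≃ₜ X} {O : (Fin (m + 1) → A) → Set X} (h : IsDeBruijnFamily G O) {η : ℝ} (hη : 0 < η) :
    ∃ (k : X ≃ₜ X) (O' : (Fin (m + 3) → A) → Set X), MovesWithin O k ∧
      IsDeBruijnFamily (G.trans k) O' ∧ (∀ u, O' u ⊆ O (Fin.init (Fin.tail u))) ∧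
      (∀ u, ∀ x ∈ O' u, ∀ y ∈ O' u, dist x y ≤ η) ∧
      ∀ u x y, k (G x) ∈ O' u → k (G y) ∈ O' u → dist x y ≤ η := by
  choose x hx hGx using h.exists_mem
  have hD : ∀ v, ∃ V, IsOpen V ∧ IsPreconnected V ∧ x v ∈ V ∧
      V ⊆ O (Fin.init v) ∩ G ⁻¹' O (Fin.tail v) ∩ ball (x v) (η / 2) := fun v ↦
    exists_isOpen_isPreconnected_mem n ((((h.isOpen _).inter
      ((h.isOpen _).preimage G.continuous)).inter isOpen_ball).mem_nhds
      ⟨⟨hx v, hGx v⟩, mem_ball_self (by positivity)⟩)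
  choose D hDo hDc hxD hD using hD
  have hDη : ∀ v, ∀ y ∈ D v, ∀ z ∈ D v, dist y z ≤ η := by
    intro v y hy z hz
    have h1 := mem_ball.1 (hD v hy).2
    have h2 := mem_ball'.1 (hD v hz).2
    linarith [dist_triangle y (x v) z]
  obtain ⟨k, O', hk, hf, hO', hO''⟩ := h.exists_refinement hn hDo hDc (fun v ↦ ⟨_, hxD v⟩)
    (fun v w hvw ↦ by
      refine disjoint_left.2 fun y hy hy' ↦ hvw (init_tail_ext ?_ ?_)
      · exact h.disjoint.eq (not_disjoint_iff.2 ⟨y, (hD v hy).1.1, (hD w hy').1.1⟩)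
      · exact h.disjoint.eq (not_disjoint_iff.2 ⟨G y, (hD v hy).1.2, (hD w hy').1.2⟩))
    (fun v y hy ↦ (hD v hy).1.1) (fun v y hy ↦ (hD v hy).1.2)
  exact ⟨k, O', hk, hf, fun u y hy ↦ (hD _ (hO' u y hy)).1.1,
    fun u y hy z hz ↦ hDη _ y (hO' u y hy) z (hO' u z hz),
    fun u y z hy hz ↦ hDη _ y (hO'' u y hy) z (hO'' u z hz)⟩

end

/-! ### The limit homeomorphism and its full shift -/

section

open Set Metric Filter

theorem exists_dependent_sequence {α : ℕ → Type*} {P : ∀ j, α j → Prop}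
    {R : ∀ j, α j → α (j + 1) → Prop} (a : α 0) (ha : P 0 a)
    (h : ∀ j a, P j a → ∃ b, P (j + 1) b ∧ R j a b) :
    ∃ s : ∀ j, α j, s 0 = a ∧ (∀ j, P j (s j)) ∧ ∀ j, R j (s j) (s (j + 1)) := by
  choose g hgP hgR using h
  let s : ∀ j, {a : α j // P j a} := fun j ↦
    Nat.rec ⟨a, ha⟩ (fun j s ↦ ⟨g j s.1 s.2, hgP j s.1 s.2⟩) j
  exact ⟨fun j ↦ (s j).1, rfl, fun j ↦ (s j).2, fun j ↦ hgR j (s j).1 (s j).2⟩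

variable {n : ℕ} {X : Type*} [MetricSpace X] [ChartedSpace (EuclideanSpace ℝ (Fin n)) X]

/-- A sequence of refining de Bruijn families converges to a homeomorphism with a full shift. -/
theorem IsDeBruijnFamily.exists_shift [CompleteSpace X] (hn : 2 ≤ n) {A : Type*} [Finite A]
    {G : X ≃ₜ X} {O : (Fin 2 → A) → Set X} (h : IsDeBruijnFamily G O)
    (h1 : ∀ u, ∀ x ∈ O u, ∀ y ∈ O u, dist x y ≤ 1)
    (h2 : ∀ u x y, G x ∈ O u → G y ∈ O u → dist x y ≤ 1) :
    ∃ G' : X ≃ₜ X, (∀ x, (∀ u, G x ∉ O u) → G' x = G x) ∧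
      ∃ x : (ℕ → A) → ℕ → X, ∀ σ k, G' (x σ k) = x σ (k + 1) ∧
        ∃ u : Fin 2 → A, u 1 = σ k ∧ x σ k ∈ closure (O u) := by
  -- Stage `j` uses words of length `2 * j + 2`: each refinement adds a letter at both ends, so the
  -- central letters persist.
  let α : ℕ → Type _ := fun j ↦ (X ≃ₜ X) × ((Fin (2 * j + 2) → A) → Set X)
  let P : ∀ j, α j → Prop := fun j p ↦ IsDeBruijnFamily p.1 p.2 ∧
    (∀ u, ∀ x ∈ p.2 u, ∀ y ∈ p.2 u, dist x y ≤ (1 / 2 : ℝ) ^ j) ∧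
    ∀ u x y, p.1 x ∈ p.2 u → p.1 y ∈ p.2 u → dist x y ≤ (1 / 2 : ℝ) ^ j
  let R : ∀ j, α j → α (j + 1) → Prop := fun j p p' ↦ ∃ k, MovesWithin p.2 k ∧
    p'.1 = p.1.trans k ∧ ∀ u : Fin (2 * j + 4) → A, p'.2 u ⊆ p.2 (Fin.init (Fin.tail u))
  obtain ⟨s, hs0, hsP, hsR⟩ := exists_dependent_sequence (P := P) (R := R) (G, O)
    ⟨h, by simpa using h1, by simpa using h2⟩ (fun j p hp ↦ by
      obtain ⟨k, O', hk, hf, hO', ha, hb⟩ :=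
        hp.1.exists_small_refinement hn (η := (1 / 2 : ℝ) ^ (j + 1)) (by positivity)
      exact ⟨(p.1.trans k, O'), ⟨hf, ha, hb⟩, k, hk, rfl, hO'⟩)
  have hmove : ∀ j x, (s (j + 1)).1 x = (s j).1 x ∨
      ∃ u, (s j).1 x ∈ (s j).2 u ∧ (s (j + 1)).1 x ∈ (s j).2 u := by
    intro j x
    obtain ⟨k, hk, hks, -⟩ := hsR j
    rw [hks]
    exact hk _
  have hd : ∀ j x, dist ((s j).1 x) ((s (j + 1)).1 x) ≤ (1 / 2 : ℝ) ^ j := by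
    intro j x
    rcases hmove j x with h | ⟨u, hu, hu'⟩
    · rw [h, dist_self]; positivity
    · exact (hsP j).2.1 u _ hu _ hu'
  have hd' : ∀ j x, dist ((s j).1.symm x) ((s (j + 1)).1.symm x) ≤ (1 / 2 : ℝ) ^ j := by
    intro j x
    obtain ⟨y, rfl⟩ := (s (j + 1)).1.surjective x
    rw [Homeomorph.symm_apply_apply]
    rcases hmove j y with h | ⟨u, hu, hu'⟩
    · rw [h, Homeomorph.symm_apply_apply, dist_self]; positivity
    -- Both inverse images lie in the preimage under stage `j` of one set `u`, whose diameter is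
    -- controlled; this is why preimages are tracked.
    · exact (hsP j).2.2 u _ _ (by rwa [Homeomorph.apply_symm_apply]) hu
  have hsum : Summable fun j : ℕ ↦ (1 / 2 : ℝ) ^ j := summable_geometric_two
  obtain ⟨G', hG'⟩ := exists_homeomorph_tendstoUniformly (fun j ↦ (s j).1) _ hsum hd hd'
  have hsub : ∀ j u, ∃ u', (s j).2 u ⊆ O u' := by
    intro j
    induction j with
    | zero => intro u; exact ⟨u, by rw [hs0]⟩
    | succ j ih =>
      intro u
      obtain ⟨k, -, -, hk⟩ := hsR j
      obtain ⟨u', hu'⟩ := ih (Fin.init (Fin.tail u))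
      exact ⟨u', (hk u).trans hu'⟩
  refine ⟨G', fun x hx ↦ ?_, ?_⟩
  · have hj : ∀ j, (s j).1 x = G x := by
      intro j
      induction j with
      | zero => rw [hs0]
      | succ j ih =>
        rcases hmove j x with h | ⟨u, hu, -⟩
        · rw [h, ih]
        · obtain ⟨u', hu'⟩ := hsub j u
          rw [ih] at hu
          exact absurd (hu' hu) (hx u')
    have := hG'.tendsto_at x
    simp only [hj] at this
    exact tendsto_nhds_unique this tendsto_const_nhds
  -- The window of `σ` from `k - 1 - j` to `k + j`, with `σ k` at position `j + 1`; negative indices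
  -- are read as `0` through `toNat`.
  · let word : (ℕ → A) → ∀ j : ℕ, ℕ → Fin (2 * j + 2) → A := fun σ j k i ↦
      σ ((k : ℤ) - 1 - j + (i : ℕ)).toNat
    have hnest : ∀ σ j k, (s (j + 1)).2 (word σ (j + 1) k) ⊆ (s j).2 (word σ j k) := by
      intro σ j k
      obtain ⟨_, -, -, hk⟩ := hsR j
      refine (hk _).trans (le_of_eq (congrArg _ ?_))
      funext i
      change σ _ = σ _
      congr 2
      simp only [Fin.val_succ, Fin.val_castSucc]
      push_cast
      ring
    have hanti : ∀ σ k j, (s j).2 (word σ j k) ⊆ (s 0).2 (word σ 0 k) := by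
      intro σ k j
      induction j with
      | zero => exact Subset.rfl
      | succ j ih => exact (hnest σ j k).trans ih
    have hp : ∀ σ j k, ∃ x ∈ (s j).2 (word σ j k), (s j).1 x ∈ (s j).2 (word σ j (k + 1)) := by
      intro σ j k
      obtain ⟨x, hx, hx'⟩ := (hsP j).1.exists_mem fun i ↦ σ ((k : ℤ) - 1 - j + (i : ℕ)).toNat
      refine ⟨x, hx, ?_⟩
      convert hx' using 2
      funext i
      change σ _ = σ _
      congr 2
      simp only [Fin.val_succ]
      push_cast
      ring
    choose p hp hp' using hp
    have hlim : ∀ σ k, ∃ x, Tendsto (fun j ↦ p σ j k) atTop (𝓝 x) := fun σ k ↦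
      cauchySeq_tendsto_of_complete (cauchySeq_of_dist_le_of_summable _ (fun j ↦
        (hsP j).2.1 _ _ (hp σ j k) _ (hnest σ j k (hp σ (j + 1) k))) hsum)
    choose x hx using hlim
    refine ⟨x, fun σ k ↦ ⟨?_, word σ 0 k, ?_, ?_⟩⟩
    · have ha : Tendsto (fun j ↦ (s j).1 (p σ j k)) atTop (𝓝 (G' (x σ k))) :=
        hG'.tendsto_comp G'.continuous.continuousAt (hx σ k)
      have hb : Tendsto (fun j ↦ dist ((s j).1 (p σ j k)) (p σ j (k + 1))) atTop (𝓝 0) :=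
        squeeze_zero (fun _ ↦ dist_nonneg)
          (fun j ↦ (hsP j).2.1 _ _ (hp' σ j k) _ (hp σ j (k + 1)))
          (tendsto_pow_atTop_nhds_zero_of_lt_one (by norm_num) (by norm_num))
      exact tendsto_nhds_unique ha ((hx σ (k + 1)).congr_dist (by simpa only [dist_comm] using hb))
    · simp [word]
    · have h0 : O = (s 0).2 := by rw [hs0]
      rw [h0]
      exact mem_closure_of_tendsto (hx σ k)
        (Eventually.of_forall fun j ↦ hanti σ k j (hp σ j k))

/-- Let `f` be a homeomorphism and `U` a connected open set. Given `4ε`-separated points `z a` of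
`U ∩ f⁻¹ U`, some perturbation of `f` supported in `U` has a full shift on the symbols `a`, realised
by `ε`-separated points. -/
theorem exists_shift_of_separated [CompleteSpace X] (hn : 2 ≤ n) {A : Type*} [Finite A]
    (f : X ≃ₜ X) {U : Set X} (hU : IsOpen U) (hUc : IsPreconnected U) (z : A → X)
    (hz : ∀ a, z a ∈ U) (hfz : ∀ a, f (z a) ∈ U) {ε : ℝ} (hε : 0 < ε)
    (hsep : ∀ a b, a ≠ b → 4 * ε ≤ dist (z a) (z b)) :
    ∃ h : X ≃ₜ X, (∀ x ∉ U, h x = x) ∧ ∃ x : (ℕ → A) → ℕ → X,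
      (∀ σ k, x σ k ∈ U ∧ h (f (x σ k)) = x σ (k + 1)) ∧
      ∀ σ σ' k, σ k ≠ σ' k → ε < dist (x σ k) (x σ' k) := by
  -- The closed set `W a` keeps limit points near `z a`. Radius `ε` separates different symbols by
  -- more than `ε`; radius `1 / 2` gives the diameter bound `1` that starts the limit construction.
  have hD : ∀ a, ∃ V, IsOpen V ∧ IsPreconnected V ∧ z a ∈ V ∧
      ∃ W, V ⊆ W ∧ IsClosed W ∧ W ⊆ U ∩ f ⁻¹' U ∩ ball (z a) (min ε (1 / 2)) := by
    intro a
    have hN : U ∩ f ⁻¹' U ∩ ball (z a) (min ε (1 / 2)) ∈ 𝓝 (z a) :=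
      ((hU.inter (hU.preimage f.continuous)).inter isOpen_ball).mem_nhds
        ⟨⟨hz a, hfz a⟩, mem_ball_self (by positivity)⟩
    obtain ⟨W, hW, hWc, hWN⟩ := exists_mem_nhds_isClosed_subset hN
    obtain ⟨V, h1, h2, h3, h4⟩ := exists_isOpen_isPreconnected_mem n hW
    exact ⟨V, h1, h2, h3, W, h4, hWc, hWN⟩
  choose V hVo hVc hzV W hVW hWc hW using hD
  have hVball : ∀ a, ∀ x ∈ W a, dist x (z a) < ε ∧ dist x (z a) < 1 / 2 := fun a x hx ↦
    lt_min_iff.1 (mem_ball.1 (hW a hx).2)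
  -- The starting family has the single set `U`, for the empty word.
  have hbase : IsDeBruijnFamily f (fun _ : Fin 0 → A ↦ U) := by
    refine ⟨fun _ ↦ hU, fun _ ↦ hUc, fun u v huv ↦ absurd (Subsingleton.elim u v) huv, fun v ↦ ?_⟩
    exact ⟨z (v 0), hz _, hfz _⟩
  have hsep' : ∀ a b, a ≠ b → ∀ x ∈ W a, ∀ y ∈ W b, ε < dist x y := by
    intro a b hab x hx y hy
    have h1 := hsep a b hab
    have h2 := (hVball a x hx).1
    have h3 := (hVball b y hy).1
    have h4 := dist_triangle4 (z a) x y (z b)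
    rw [dist_comm (z a) x] at h4
    linarith
  have hV1 : ∀ a, ∀ x ∈ V a, ∀ y ∈ V a, dist x y ≤ 1 := by
    intro a x hx y hy
    have h2 := (hVball a x (hVW a hx)).2
    have h3 := (hVball a y (hVW a hy)).2
    linarith [dist_triangle_right x y (z a)]
  obtain ⟨k, O, hk, hO, hOt, hOi⟩ := hbase.exists_refinement hn (D := fun v : Fin 1 → A ↦ V (v 0))
    (fun v ↦ hVo _) (fun v ↦ hVc _) (fun v ↦ ⟨_, hzV _⟩)
    (fun v w hvw ↦ by
      have hne : v 0 ≠ w 0 := fun h ↦ hvw (funext fun i ↦ by obtain rfl : i = 0 := Fin.ext (by omega); exact h)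
      refine disjoint_left.2 fun x hx hx' ↦ ?_
      have := hsep' _ _ hne x (hVW _ hx) x (hVW _ hx')
      rw [dist_self] at this
      exact absurd this hε.not_gt)
    (fun v x hx ↦ (hW _ (hVW _ hx)).1.1) (fun v x hx ↦ (hW _ (hVW _ hx)).1.2)
  have hOV : ∀ u, O u ⊆ V (u 1) := fun u x hx ↦ hOt u x hx
  obtain ⟨G', hG', x, hx⟩ := hO.exists_shift hn
    (fun u x hx y hy ↦ hV1 _ x (hOV u hx) y (hOV u hy))
    (fun u x y hx hy ↦ hV1 _ x (hOi u x hx) y (hOi u y hy))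
  have hxW : ∀ σ k, x σ k ∈ W (σ k) := by
    intro σ k
    obtain ⟨-, u, hu, hxu⟩ := hx σ k
    rw [← hu]
    exact (hWc _).closure_subset_iff.2 ((hOV u).trans (hVW _)) hxu
  refine ⟨f.symm.trans G', fun y hy ↦ ?_, x, fun σ k ↦ ⟨(hW _ (hxW σ k)).1.1, ?_⟩,
    fun σ σ' k hne ↦ hsep' _ _ hne _ (hxW σ k) _ (hxW σ' k)⟩
  · have hky : k y = y := by
      rcases hk y with h | ⟨_, h, -⟩
      · exact h
      · exact absurd h hy
    have hfy : (f.trans k) (f.symm y) = y := by simpa using hky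
    have := hG' (f.symm y) (fun u hu ↦ by
      rw [hfy] at hu
      exact hy (hW _ (hVW _ (hOV u hu))).1.1)
    rw [hfy] at this
    simpa using this
  · simpa using (hx σ k).1

end

/-! ### Gluing perturbations in annuli around a periodic point -/

section

open Set Metric Filter

/-- Homeomorphisms supported in disjoint sets of rapidly decreasing diameter can be glued. -/
theorem exists_homeomorph_glue {X : Type*} [MetricSpace X] [CompleteSpace X] (U : ℕ → Set X)
    (hUd : Pairwise (Function.onFun Disjoint U))
    (hU : ∀ j, ∀ x ∈ U j, ∀ y ∈ U j, dist x y ≤ (1 / 2 : ℝ) ^ j)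
    (h : ℕ → X ≃ₜ X) (hh : ∀ j, ∀ x ∉ U j, h j x = x) :
    ∃ H : X ≃ₜ X, (∀ j, ∀ x ∈ U j, H x = h j x) ∧ ∀ x, (∀ j, x ∉ U j) → H x = x := by
  let G : ℕ → X ≃ₜ X := fun j ↦ Nat.rec (Homeomorph.refl X) (fun j g ↦ g.trans (h j)) j
  have hG : ∀ j x, G (j + 1) x = h j (G j x) := fun j x ↦ rfl
  have hfix : ∀ j x, (∀ i < j, x ∉ U i) → G j x = x := by
    intro j
    induction j with
    | zero => intro x _; rfl
    | succ j ih =>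
      intro x hx
      rw [hG, ih x fun i hi ↦ hx i (by omega), hh j x (hx j (by omega))]
  have hfix' : ∀ j, ∀ x ∈ U j, G j x = x := fun j x hx ↦ hfix j x fun i hi hxi ↦
    hi.ne (hUd.eq (not_disjoint_iff.2 ⟨x, hxi, hx⟩))
  have heq : ∀ i j, i < j → ∀ x ∈ U i, G j x = h i x := by
    intro i j hij x hx
    induction j, hij using Nat.le_induction with
    | base => rw [hG, hfix' i x hx]
    | succ j hij ih =>
      rw [hG, ih, hh]
      intro hj
      have := hUd.eq (not_disjoint_iff.2 ⟨_, mem_of_forall_notMem_eq (hh i) hx, hj⟩)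
      omega
  have hmove : ∀ j y, h j y = y ∨ y ∈ U j ∧ h j y ∈ U j := by
    intro j y
    by_cases hy : y ∈ U j
    · exact Or.inr ⟨hy, mem_of_forall_notMem_eq (hh j) hy⟩
    · exact Or.inl (hh j y hy)
  obtain ⟨H, hH⟩ := exists_homeomorph_tendstoUniformly G (fun j ↦ (1 / 2 : ℝ) ^ j)
    summable_geometric_two
    (fun j x ↦ by
      rw [hG]
      rcases hmove j (G j x) with h1 | ⟨h1, h2⟩
      · rw [h1, dist_self]; positivity
      · exact hU j _ h1 _ h2)
    (fun j x ↦ by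
      obtain ⟨y, rfl⟩ := (G (j + 1)).surjective x
      rw [Homeomorph.symm_apply_apply, hG]
      rcases hmove j (G j y) with h1 | ⟨h1, h2⟩
      · rw [h1, Homeomorph.symm_apply_apply, dist_self]; positivity
      -- `G j` is the identity on `U j`, since the earlier supports are disjoint from it; so the
      -- inverses also differ by at most the diameter of `U j`.
      · have h3 : (G j).symm (h j (G j y)) = h j (G j y) := by
          rw [Homeomorph.symm_apply_eq, hfix' j _ h2]
        have h4 : G j y = y := (G j).injective (hfix' j _ h1)
        rw [h3]
        rw [h4] at h1 h2 ⊢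
        exact hU j _ h2 _ h1)
  refine ⟨H, fun j x hx ↦ ?_, fun x hx ↦ ?_⟩
  · refine tendsto_nhds_unique (hH.tendsto_at x) (tendsto_const_nhds.congr' ?_)
    filter_upwards [eventually_gt_atTop j] with i hi
    exact (heq j i hi x hx).symm
  · refine tendsto_nhds_unique (hH.tendsto_at x) (tendsto_const_nhds.congr fun i ↦ ?_)
    exact (hfix i x fun j _ ↦ hx j).symm

theorem exists_homeomorph_iterate {X : Type*} [TopologicalSpace X] (F : X ≃ₜ X) (q : ℕ) :
    ∃ f : X ≃ₜ X, ∀ x, f x = F^[q] x := by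
  induction q with
  | zero => exact ⟨Homeomorph.refl X, fun x ↦ rfl⟩
  | succ q ih =>
    obtain ⟨f, hf⟩ := ih
    exact ⟨F.trans f, fun x ↦ by simp [hf]⟩

variable {n : ℕ} {X : Type*} [MetricSpace X] [ChartedSpace (EuclideanSpace ℝ (Fin n)) X]

/-- A perturbation supported in `U` creates a full shift with about `ε ^ (-n)` symbols at some
small scale `ε`. -/
theorem LocallyBilipschitzCharts.exists_shift [CompleteSpace X] (hX : LocallyBilipschitzCharts n X)
    (hn : 2 ≤ n) (f : X ≃ₜ X) {U : Set X} (hU : IsOpen U) (hUc : IsPreconnected U)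
    (hne : ∃ x ∈ U, f x ∈ U) {δ : ℝ} (hδ : 0 < δ) :
    ∃ h : X ≃ₜ X, (∀ x ∉ U, h x = x) ∧ ∃ ε, 0 < ε ∧ ε < δ ∧ ∃ M : ℕ, 0 < M ∧
      (n - δ) * |Real.log ε| ≤ n * Real.log M ∧
      ∃ x : (ℕ → Fin n → Fin M) → ℕ → X,
        (∀ σ k, x σ k ∈ U ∧ h (f (x σ k)) = x σ (k + 1)) ∧
        ∀ σ σ' k, σ k ≠ σ' k → ε < dist (x σ k) (x σ' k) := by
  obtain ⟨c, hc, hgrid⟩ := hX.exists_grid (hU.inter (hU.preimage f.continuous)) hne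
  obtain ⟨M, hM, hMδ, hlog⟩ := exists_grid_scale n (c := c / 4) (by positivity) hδ
  have hM' : (0 : ℝ) < M := by exact_mod_cast hM
  obtain ⟨z, hz, hsep⟩ := hgrid M hM
  obtain ⟨h, hh, x, hx, hx'⟩ := exists_shift_of_separated hn f hU hUc z (fun a ↦ (hz a).1)
    (fun a ↦ (hz a).2) (ε := c / 4 / M) (by positivity) (fun a b hab ↦ by
      refine (le_of_eq ?_).trans (hsep a b hab)
      ring)
  exact ⟨h, hh, c / 4 / M, by positivity, hMδ, M, hM, hlog, x, hx, hx'⟩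

/-- Arbitrarily close to a fixed point `p` of `f` there are disjoint connected open sets `U j`
meeting their images under `f`. -/
theorem exists_disjoint_annuli (hn : 2 ≤ n) (f : X ≃ₜ X) {O : Set X} (hO : IsOpen O) {p : X}
    (hp : p ∈ O) (hfp : f p = p) :
    ∃ U : ℕ → Set X, (∀ j, IsOpen (U j)) ∧ (∀ j, IsPreconnected (U j)) ∧
      Pairwise (Function.onFun Disjoint U) ∧ (∀ j, U j ⊆ O) ∧ (∀ j, p ∉ U j) ∧
      (∀ j, ∀ x ∈ U j, ∀ y ∈ U j, dist x y ≤ (1 / 2 : ℝ) ^ j) ∧ ∀ j, ∃ x ∈ U j, f x ∈ U j := by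
  obtain ⟨r, hr, hrO⟩ := exists_closedBall_subset_chart n p (hO.mem_nhds hp)
  set φ := chartAt (EuclideanSpace ℝ (Fin n)) p with hφ
  have hps : p ∈ φ.source := mem_chart_source _ p
  have hsmall : ∀ j : ℕ, ∃ ρ > 0, ∀ x ∈ φ.source, dist (φ x) (φ p) < ρ →
      dist x p < (1 / 2 : ℝ) ^ (j + 1) := by
    intro j
    have h1 := φ.continuousAt_symm (φ.map_source hps)
    obtain ⟨ρ, hρ, h2⟩ := Metric.continuousAt_iff.1 h1 ((1 / 2 : ℝ) ^ (j + 1)) (by positivity)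
    refine ⟨ρ, hρ, fun x hx hxρ ↦ ?_⟩
    have := h2 hxρ
    rwa [φ.left_inv hx, φ.left_inv hps] at this
  choose ρ hρ hρs using hsmall
  have hstep : ∀ R > 0, ∃ R' > 0, R' < R ∧
      ∃ x, x ∈ chartAnnulus n p R' R ∧ f x ∈ chartAnnulus n p R' R := by
    intro R hR
    have hN : φ.source ∩ φ ⁻¹' ball (φ p) R ∈ 𝓝 p :=
      Filter.inter_mem (φ.open_source.mem_nhds hps)
        ((φ.continuousAt hps).preimage_mem_nhds (ball_mem_nhds _ hR))
    have hN' : f ⁻¹' (φ.source ∩ φ ⁻¹' ball (φ p) R) ∈ 𝓝 p :=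
      f.continuous.continuousAt.preimage_mem_nhds (by rwa [hfp])
    obtain ⟨V, hVN, hVo, hpV⟩ := _root_.mem_nhds_iff.1 (Filter.inter_mem hN hN')
    obtain ⟨x, hxV, hxp⟩ :=
      (infinite_of_isOpen_manifold n hn hVo ⟨p, hpV⟩).exists_notMem_finite (finite_singleton p)
    obtain ⟨⟨hxs, hxR⟩, hfxs, hfxR⟩ := hVN hxV
    have hxp' : x ≠ p := hxp
    have h1 : 0 < dist (φ x) (φ p) := dist_pos.2 fun h ↦ hxp' (φ.injOn hxs hps h)
    have h2 : 0 < dist (φ (f x)) (φ p) := dist_pos.2 fun h ↦ hxp'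
      (f.injective ((φ.injOn hfxs hps h).trans hfp.symm))
    -- Both `x` and `f x` differ from `p`, so an inner radius below both distances puts them in the
    -- same annulus.
    obtain ⟨R', hR', hlt⟩ := exists_between (lt_min (lt_min h1 h2) hR)
    exact ⟨R', hR', hlt.trans_le (min_le_right _ _), x,
      ⟨hxs, hlt.trans_le ((min_le_left _ _).trans (min_le_left _ _)), hxR⟩,
      ⟨hfxs, hlt.trans_le ((min_le_left _ _).trans (min_le_right _ _)), hfxR⟩⟩
  obtain ⟨R, -, hRP, hRR⟩ := exists_dependent_sequence (α := fun _ ↦ ℝ)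
    (P := fun j R ↦ 0 < R ∧ R ≤ r ∧ R ≤ ρ j)
    (R := fun j a b ↦ b ≤ a ∧ ∃ x, x ∈ chartAnnulus n p b a ∧ f x ∈ chartAnnulus n p b a)
    (min r (ρ 0)) ⟨lt_min hr (hρ 0), min_le_left _ _, min_le_right _ _⟩ (fun j a ha ↦ by
      obtain ⟨b, hb, hba, x, hx, hfx⟩ := hstep a ha.1
      refine ⟨min b (ρ (j + 1)), ⟨lt_min hb (hρ _), ?_, min_le_right _ _⟩,
        (min_le_left _ _).trans hba.le, x, ?_, ?_⟩
      · exact (min_le_left _ _).trans (hba.le.trans ha.2.1)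
      · exact ⟨hx.1, (min_le_left _ _).trans_lt hx.2.1, hx.2.2⟩
      · exact ⟨hfx.1, (min_le_left _ _).trans_lt hfx.2.1, hfx.2.2⟩)
  have hanti : Antitone R := antitone_nat_of_succ_le fun j ↦ (hRR j).1
  refine ⟨fun j ↦ chartAnnulus n p (R (j + 1)) (R j), fun j ↦ isOpen_chartAnnulus p _ _,
    fun j ↦ isPreconnected_chartAnnulus hn p (hRP (j + 1)).1.le fun x hx ↦ ?_, ?_,
    fun j x hx ↦ ?_, fun j hj ↦ ?_, fun j x hx y hy ↦ ?_, fun j ↦ (hRR j).2⟩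
  · exact (hrO (closedBall_subset_closedBall (hRP j).2.1 (ball_subset_closedBall hx))).1
  · have hlt : ∀ i j, i < j → Disjoint (chartAnnulus n p (R (i + 1)) (R i))
        (chartAnnulus n p (R (j + 1)) (R j)) := fun i j hij ↦ by
      refine disjoint_left.2 fun x hx hx' ↦ ?_
      exact absurd (hx.2.1.trans hx'.2.2) (hanti (Nat.succ_le_of_lt hij)).not_gt
    intro i j hij
    rcases hij.lt_or_gt with h | h
    · exact hlt i j h
    · exact (hlt j i h).symm
  · have := (hrO (closedBall_subset_closedBall (hRP j).2.1
      (ball_subset_closedBall (mem_ball.2 hx.2.2)))).2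
    rwa [mem_preimage, φ.left_inv hx.1] at this
  · have h1 := hj.2.1
    rw [← hφ, dist_self] at h1
    exact absurd (hRP (j + 1)).1 h1.not_gt
  · have h1 := hρs j x hx.1 (hx.2.2.trans_le (hRP j).2.2)
    have h2 := hρs j y hy.1 (hy.2.2.trans_le (hRP j).2.2)
    have h3 := dist_triangle_right x y p
    rw [pow_succ] at h1 h2
    linarith

/-- Near a periodic point of period `q`, whose neighbourhood `O` is disjoint from its first `q - 1`
iterates, a perturbation supported in `O` has upper metric mean dimension at least `n / q`. -/
theorem LocallyBilipschitzCharts.exists_perturbation [CompleteSpace X]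
    (hX : LocallyBilipschitzCharts n X) (hn : 2 ≤ n) (F : X ≃ₜ X) {q : ℕ} (hq : 0 < q) {O : Set X}
    (hO : IsOpen O) {p : X} (hp : p ∈ O) (hFp : F^[q] p = p)
    (hFO : ∀ i, 0 < i → i < q → ∀ x ∈ O, F^[i] x ∉ O) :
    ∃ H : X ≃ₜ X, (∀ x ∉ O, H x = x) ∧ H p = p ∧
      (((n : ℝ) / q : ℝ) : EReal) ≤ upperMDim (F.trans H) := by
  obtain ⟨f, hf⟩ := exists_homeomorph_iterate F q
  obtain ⟨U, hUo, hUc, hUd, hUO, hpU, hUdiam, hUne⟩ :=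
    exists_disjoint_annuli hn f hO hp ((hf p).trans hFp)
  choose h hh ε hε hεδ M hM hlog x hx hsep using fun j : ℕ ↦
    hX.exists_shift hn f (hUo j) (hUc j) (hUne j) (δ := 1 / ((j : ℝ) + 1)) (by positivity)
  obtain ⟨H, hH, hHid⟩ := exists_homeomorph_glue U hUd hUdiam h hh
  have hHO : ∀ y ∉ O, H y = y := fun y hy ↦ hHid y fun j hj ↦ hy (hUO j hj)
  refine ⟨H, hHO, hHid p hpU, ?_⟩
  -- Before time `q` orbits from `O` avoid `O`, where `H` is supported; so the `q`-th iterate of the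
  -- perturbed map on `O` is `H ∘ f`.
  have hit : ∀ i < q, ∀ y ∈ O, (F.trans H)^[i] y = F^[i] y := by
    intro i
    induction i with
    | zero => intro _ y _; rfl
    | succ i ih =>
      intro hi y hy
      rw [Function.iterate_succ_apply', ih (by omega) y hy, Homeomorph.trans_apply,
        ← Function.iterate_succ_apply' F, hHO _ (hFO _ (by omega) hi y hy)]
  have hitq : ∀ y ∈ O, (F.trans H)^[q] y = H (f y) := by
    intro y hy
    obtain ⟨m, rfl⟩ := Nat.exists_eq_succ_of_ne_zero hq.ne'
    rw [Function.iterate_succ_apply', hit m (by omega) y hy, Homeomorph.trans_apply,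
      ← Function.iterate_succ_apply' F, hf]
  refine le_upperMDim_of_sepEntropy_ge _ _ fun δ hδ ↦ ?_
  obtain ⟨j, hj⟩ := exists_nat_one_div_lt hδ
  have : Nonempty (Fin (M j)) := ⟨⟨0, hM j⟩⟩
  refine ⟨ε j, hε j, (hεδ j).trans hj, le_trans ?_ (le_sepEntropy_of_shift (F.trans H) hq (hε j)
    (x j) (fun σ k ↦ ?_) (hsep j))⟩
  · rw [EReal.coe_le_coe_iff]
    have hq' : (1 : ℝ) ≤ q := by exact_mod_cast hq
    have h1 : Real.log (Fintype.card (Fin n → Fin (M j))) = n * Real.log (M j) := by simp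
    rw [h1, le_div_iff₀ (by positivity)]
    refine le_trans ?_ (hlog j)
    have h2 : ((n : ℝ) / q - δ) * |Real.log (ε j)| * q = (n - δ * q) * |Real.log (ε j)| := by
      field_simp
    rw [h2]
    gcongr
    nlinarith
  · rw [hitq _ (hUO j (hx j σ k).1)]
    have h1 := (hx j σ k).2
    -- `h j` preserves `U j` and sends this point into it, so the point was already there and `H`
    -- acts on it as `h j`.
    have h2 : f (x j σ k) ∈ U j := by
      rw [← mem_iff_of_forall_notMem_eq (hh j), h1]
      exact (hx j σ (k + 1)).1
    rw [hH j _ h2, h1]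

end

/-! ### Creating a periodic point -/

section

open Set Metric Filter

/-- A homeomorphism of a compact manifold is approximated by one having a periodic point whose
period is the first return time of a small open set. -/
theorem exists_periodic_perturbation (n : ℕ) {X : Type*} [MetricSpace X]
    [ChartedSpace (EuclideanSpace ℝ (Fin n)) X] [CompactSpace X] [Nonempty X]
    (F : X ≃ₜ X) {ε : ℝ} (hε : 0 < ε) :
    ∃ (h : X ≃ₜ X) (O : Set X) (p : X) (q : ℕ), IsOpen O ∧ p ∈ O ∧ 0 < q ∧
      (∀ x ∈ O, ∀ y ∈ O, dist x y < ε) ∧ (∀ x ∉ O, h x = x) ∧ (F.trans h)^[q] p = p ∧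
      ∀ i, 0 < i → i < q → ∀ x ∈ O, (F.trans h)^[i] x ∉ O := by
  have hV : ∀ x : X, ∃ V, IsOpen V ∧ IsPreconnected V ∧ x ∈ V ∧ V ⊆ ball x (ε / 2) := fun x ↦
    exists_isOpen_isPreconnected_mem n (ball_mem_nhds x (by positivity))
  choose V hVo hVc hxV hVb using hV
  obtain ⟨t, ht⟩ := CompactSpace.elim_nhds_subcover V fun x ↦ (hVo x).mem_nhds (hxV x)
  have hcov : ∀ y : X, ∃ x : t, y ∈ V x := by
    intro y
    have : y ∈ ⋃ x ∈ t, V x := by rw [ht]; trivial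
    simp only [mem_iUnion] at this
    obtain ⟨x, hx, hy⟩ := this
    exact ⟨⟨x, hx⟩, hy⟩
  choose c hc using hcov
  let x₀ : X := Classical.arbitrary X
  obtain ⟨i, j, hij, hcij⟩ : ∃ i j : ℕ, i < j ∧ c (F^[i] x₀) = c (F^[j] x₀) := by
    obtain ⟨i, j, hne, h⟩ := Finite.exists_ne_map_eq_of_infinite fun i : ℕ ↦ c (F^[i] x₀)
    rcases hne.lt_or_gt with h' | h'
    · exact ⟨i, j, h', h⟩
    · exact ⟨j, i, h', h.symm⟩
  set O := V (c (F^[i] x₀)) with hO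
  have hret : ∃ q, 0 < q ∧ ∃ y ∈ O, F^[q] y ∈ O := by
    refine ⟨j - i, by omega, F^[i] x₀, hc _, ?_⟩
    rw [← Function.iterate_add_apply, Nat.sub_add_cancel hij.le, hO, hcij]
    exact hc _
  classical
  -- The return time is minimal over all points of `O`, so no point of `O` returns earlier and a
  -- move inside `O` leaves those iterates unchanged.
  obtain ⟨hq, y, hy, hFy⟩ := Nat.find_spec hret
  have hmin : ∀ i, 0 < i → i < Nat.find hret → ∀ x ∈ O, F^[i] x ∉ O := by
    intro i hi hiq x hx hx'
    exact Nat.find_min hret hiq ⟨hi, x, hx, hx'⟩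
  generalize Nat.find hret = q at hq hFy hmin
  obtain ⟨h, hh, hhy⟩ := exists_homeomorph_move n (hVo _) (hVc _) hFy hy
  have hit : ∀ i < q, ∀ x ∈ O, (F.trans h)^[i] x = F^[i] x := by
    intro i
    induction i with
    | zero => intro _ x _; rfl
    | succ i ih =>
      intro hi x hx
      rw [Function.iterate_succ_apply', ih (by omega) x hx, Homeomorph.trans_apply,
        ← Function.iterate_succ_apply' F, hh _ (hmin _ (by omega) hi x hx)]
  refine ⟨h, O, y, q, hVo _, hy, hq, fun a ha b hb ↦ ?_, hh, ?_, fun i hi hiq x hx ↦ ?_⟩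
  · have h1 := mem_ball.1 (hVb _ ha)
    have h2 := mem_ball'.1 (hVb _ hb)
    exact (dist_triangle _ _ _).trans_lt (by linarith)
  · obtain ⟨m, rfl⟩ := Nat.exists_eq_succ_of_ne_zero hq.ne'
    rw [Function.iterate_succ_apply', hit m (by omega) y hy, Homeomorph.trans_apply,
      ← Function.iterate_succ_apply' F, hhy]
  · rw [hit i hiq x hx]
    exact hmin i hi hiq x hx

end

end MetricMeanDimension

end

/-! ### The two density statements -/

open MetricMeanDimension in
/-- Let `X` be a closed (compact, connected, without boundary) smooth Riemannian manifold of
dimension `n ≥ 2`, with the metric given by infima of lengths of paths. -/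
theorem proposition5p5 (n : ℕ) (hn : 2 ≤ n) (X : Type*) [MetricSpace X] [CompactSpace X]
    [ConnectedSpace X] [ChartedSpace (EuclideanSpace ℝ (Fin n)) X] [IsManifold (𝓡 n) ∞ X]
    [Bundle.RiemannianBundle (fun x : X => TangentSpace (𝓡 n) x)]
    [IsContMDiffRiemannianBundle (𝓡 n) ∞ (EuclideanSpace ℝ (Fin n))
      (fun x : X => TangentSpace (𝓡 n) x)]
    [IsRiemannianManifold (𝓡 n) X] :
    Dense {F : {F : X ≃ₜ X // ∃ x, F x = x} | upperMDim (F : X ≃ₜ X) = ((n : ℝ) : EReal)} ∧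
      Dense {F : X ≃ₜ X | 0 < upperMDim F} := by
  have hX := locallyBilipschitzCharts_of_isRiemannianManifold n X
  constructor
  · rintro ⟨F, p, hp⟩
    rw [closure_subtype, mem_closure_homeo_iff]
    intro ε hε
    obtain ⟨H, hH, hHp, hdim⟩ := hX.exists_perturbation hn F one_pos
      (Metric.isOpen_ball (x := p) (ε := ε / 2)) (Metric.mem_ball_self (by positivity)) hp
      (fun i hi hi' ↦ by omega)
    refine ⟨F.trans H, ⟨⟨F.trans H, p, by simp [hp, hHp]⟩, ?_, rfl⟩, fun x ↦ ?_⟩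
    · refine le_antisymm (hX.upperMDim_le _) ?_
      simpa using hdim
    · by_cases hx : F x ∈ Metric.ball p (ε / 2)
      · have h1 := Metric.mem_ball.1 hx
        have h2 := Metric.mem_ball'.1 (mem_of_forall_notMem_eq hH hx)
        exact (dist_triangle _ p _).trans_lt (by simp only [Homeomorph.trans_apply]; linarith)
      · simpa [hH _ hx] using hε
  · intro F
    rw [mem_closure_homeo_iff]
    intro ε hε
    obtain ⟨h, O, p, q, hO, hp, hq, hdiam, hh, hper, hret⟩ := exists_periodic_perturbation n F hε
    obtain ⟨H, hH, -, hdim⟩ := hX.exists_perturbation hn (F.trans h) hq hO hp hper hret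
    refine ⟨(F.trans h).trans H, ?_, fun x ↦ ?_⟩
    · refine lt_of_lt_of_le ?_ hdim
      have h1 : (0 : ℝ) < n := by exact_mod_cast (by omega : 0 < n)
      have h2 : (0 : ℝ) < q := by exact_mod_cast hq
      exact_mod_cast div_pos h1 h2
    · by_cases hx : F x ∈ O
      -- Both perturbations are supported in the same set `O`, so together they move a point by less
      -- than `ε`.
      · exact hdiam _ hx _ (mem_of_forall_notMem_eq hH (mem_of_forall_notMem_eq hh hx))
      · simpa [hh _ hx, hH _ hx] using hε
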